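/- **Setting.** Fix $p\in(0,1)$, $q=1-p$. Let $\Xi^{(1)},\Xi^{(2)},\dots$ be i.i.d. random infinite binary strings whose letters are i.i.d. with $\mathbb P(1)=p$, $\mathbb P(0)=q$. The trie of a finite set of distinct strings is constructed recursively: it is empty if the set is empty; it is a single (external) node storing the string if the set has one element; otherwise it has a root that stores no string (an internal node), whose left and right subtrees are the tries of the strings beginning with $0$ and with $1$, respectively, constructed by the same procedure from the following letters. Let $W_n$ be the number of internal nodes of the trie of $\Xi^{(1)},\dots,\Xi^{(n)}$, and let $\widetilde W_\lambda$ be the number of internal nodes of the trie of $\Xi^{(1)},\dots,\Xi^{(N_\lambda)}$, where $N_\lambda\sim\mathrm{Po}(\lambda)$ is independent of the strings. Let $H=-p\ln p-q\ln q$. **Theorem.** The expectations $\mathbb E W_n$ and $\mathbb E\widetilde W_\lambda$ are finite, and the following hold. (i) If $\ln p/\ln q$ is irrational, then $$\frac{\mathbb E\widetilde W_\lambda}{\lambda}\to\frac1H\quad(\lambda\to\infty),\qquad \frac{\mathbb E W_n}{n}\to\frac1H\quad(n\to\infty).$$ (ii) If $\ln p/\ln q$ is rational, let $d>0$ be the largest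 positive real number such that $\ln p$ and $\ln q$ are both integer multiples of $d$. Then there is a continuous $d$-periodic function $\psi:\mathbb R\to\mathbb R$ with $\int_0^d\psi(t)\,dt=0$, whose Fourier coefficients are $$\frac1d\int_0^d\psi(t)e^{-2\pi i k t/d}\,dt=\frac{\Gamma(1-2\pi i k/d)}{1+2\pi i k/d}\qquad(k\in\mathbb Z,\ k\ne0),$$ and which is for every $t\in\mathbb R$ the sum of its (unconditionally convergent) Fourier series, $$\psi(t)=\sum_{k\ne0}\frac{\Gamma(1-2\pi i k/d)}{1+2\pi i k/d}e^{2\pi i k t/d}=\sum_{k\neq0}\frac{2\pi i k}{d}\,\Gamma\Bigl(-1-\frac{2\pi i k}{d}\Bigr)e^{2\pi i k t/d},$$ such that $$\frac{\mathbb E\widetilde W_\lambda}{\lambda}=\frac1H+\frac1H\psi(\ln\lambda)+o(1)\quad(\lambda\to\infty),\qquad \frac{\mathbb E W_n}{n}=\frac1H+\frac1H\psi(\ln n)+o(1)\quad(n\to\infty).$$ -/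

import Mathlib

open MeasureTheory ProbabilityTheory Filter Asymptotics
open scoped NNReal Topology

/-- Infinite strings over the alphabet `{0, 1}`; `false` is the letter `0`, `true` the letter `1`. -/
abbrev BinString : Type := ℕ → Bool

/-- A binary trie: empty; or a single external node (leaf) storing a string; or an internal node,
which stores no string, together with its left and right subtrees (each possibly empty).
A leaf at the end of the path `α` records the remainder `s` of the stored string `α s`. -/
inductive BinaryTrie : Type
  | empty : BinaryTrie
  | leaf (s : BinString) : BinaryTrie
  | node (left right : BinaryTrie) : BinaryTrie

namespace BinaryTrie

/-- The number of internal nodes. -/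
def numInternal : BinaryTrie → ℕ
  | empty => 0
  | leaf _ => 0
  | node l r => 1 + numInternal l + numInternal r

open scoped Classical in
/-- The strings of `S` that begin with the letter `b`, with that first letter removed. -/
noncomputable def branch (S : Finset BinString) (b : Bool) : Finset BinString :=
  (S.filter (fun s => s 0 = b)).image (fun s i => s (i + 1))

/-- The first `k` letters tell the strings of `S` apart. -/
def Separated (S : Finset BinString) (k : ℕ) : Prop :=
  ∀ s ∈ S, ∀ t ∈ S, (∀ i < k, s i = t i) → s = t

/-- The least number of letters that tell the strings of `S` apart. It serves only to show that
the recursive construction of the trie terminates. -/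
noncomputable def sepDepth (S : Finset BinString) : ℕ := sInf {k | Separated S k}

theorem exists_separated (S : Finset BinString) : ∃ k, Separated S k := by
  classical
  have h : ∀ x : BinString × BinString, ∃ k, (∀ i < k, x.1 i = x.2 i) → x.1 = x.2 := by
    intro x
    by_cases hx : x.1 = x.2
    · exact ⟨0, fun _ => hx⟩
    · obtain ⟨i, hi⟩ := Function.ne_iff.mp hx
      exact ⟨i + 1, fun H => absurd (H i (Nat.lt_succ_self i)) hi⟩
  choose f hf using h
  refine ⟨(S ×ˢ S).sup f, fun s hs t ht H => hf (s, t) fun i hi => H i ?_⟩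
  exact lt_of_lt_of_le hi (Finset.le_sup (f := f) (Finset.mk_mem_product hs ht))

theorem sepDepth_branch_lt (S : Finset BinString) (b : Bool) (h : 2 ≤ S.card) :
    sepDepth (branch S b) < sepDepth S := by
  classical
  have hS : Separated S (sepDepth S) := Nat.sInf_mem (exists_separated S)
  obtain ⟨k, hk⟩ : ∃ k, sepDepth S = k + 1 := by
    refine Nat.exists_eq_succ_of_ne_zero fun h0 => ?_
    obtain ⟨s, hs, t, ht, hst⟩ := Finset.one_lt_card.mp h
    refine hst (hS s hs t ht fun i hi => ?_)
    omega
  rw [hk] at hS ⊢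
  refine Nat.lt_succ_of_le (Nat.sInf_le ?_)
  intro s hs t ht H
  simp only [branch, Finset.mem_image, Finset.mem_filter] at hs ht
  obtain ⟨s', ⟨hs', hsb⟩, rfl⟩ := hs
  obtain ⟨t', ⟨ht', htb⟩, rfl⟩ := ht
  have : s' = t' := by
    refine hS s' hs' t' ht' fun i hi => ?_
    cases i with
    | zero => rw [hsb, htb]
    | succ i => exact H i (by omega)
  rw [this]

open scoped Classical in
/-- The trie constructed from a finite set `S` of (distinct) infinite strings: if `S` is empty, the
trie is empty; if `S` has exactly one element, the trie is a single external node storing it;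
otherwise the trie begins with an internal node, the strings beginning with `0` are passed to
the left subtree and those beginning with `1` to the right subtree, and the subtrees are
constructed by the same procedure from the next letters. -/
noncomputable def ofStrings (S : Finset BinString) : BinaryTrie :=
  if h : 2 ≤ S.card then
    node (ofStrings (branch S false)) (ofStrings (branch S true))
  else if h1 : S.Nonempty then leaf h1.choose
  else empty
termination_by sepDepth S
decreasing_by
  · exact sepDepth_branch_lt S false h
  · exact sepDepth_branch_lt S true h

end BinaryTrie

open scoped Classical in
/-- The number of internal nodes of the trie constructed from the first `n` strings of the
sequence `x` of strings. -/
noncomputable def trieSize (x : ℕ → BinString) (n : ℕ) : ℕ :=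
  (BinaryTrie.ofStrings ((Finset.range n).image x)).numInternal

/-- `gcd(x, y)` for real `x`, `y`: the largest positive real `d` such that both `x` and `y` are
integer multiples of `d` (meaningful when `y ≠ 0` and `x / y` is rational). -/
noncomputable def realGcd (x y : ℝ) : ℝ :=
  sSup {d : ℝ | 0 < d ∧ (∃ m : ℤ, x = m * d) ∧ ∃ n : ℤ, y = n * d}

/-- For reals with rational ratio and `y ≠ 0` the largest common divisor really exists. -/
theorem realGcd_isGreatest {x y : ℝ} (hy : y ≠ 0) (h : ¬ Irrational (x / y)) :
    IsGreatest {d : ℝ | 0 < d ∧ (∃ m : ℤ, x = m * d) ∧ ∃ n : ℤ, y = n * d} (realGcd x y) := by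
  suffices H : ∃ d₀, IsGreatest {d : ℝ | 0 < d ∧ (∃ m : ℤ, x = m * d) ∧ ∃ n : ℤ, y = n * d} d₀ by
    obtain ⟨d₀, hd₀⟩ := H
    have h1 : realGcd x y = d₀ := hd₀.csSup_eq
    rw [h1]
    exact hd₀
  obtain ⟨r, hr⟩ : ∃ r : ℚ, (r : ℝ) = x / y := by
    simpa [Irrational] using h
  have hden : (0 : ℝ) < r.den := by exact_mod_cast r.den_pos
  have hxr : x = r.num * (y / r.den) := by
    have h2 : (r : ℝ) = r.num / r.den := by exact_mod_cast (Rat.num_div_den r).symm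
    rw [h2, eq_div_iff hy] at hr
    rw [← hr]
    ring
  refine ⟨|y| / r.den, ⟨by positivity, ?_, ?_⟩, ?_⟩
  · rcases abs_choice y with hy' | hy' <;> rw [hy']
    · exact ⟨r.num, hxr⟩
    · exact ⟨-r.num, by push_cast; rw [hxr]; ring⟩
  · rcases abs_choice y with hy' | hy' <;> rw [hy']
    · exact ⟨r.den, by push_cast; field_simp⟩
    · exact ⟨-r.den, by push_cast; field_simp⟩
  · rintro d ⟨hd, ⟨m, hm⟩, ⟨n, hn⟩⟩
    have hn0 : n ≠ 0 := by
      rintro rfl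
      exact hy (by simpa using hn)
    have h3 : m * (r.den : ℤ) = r.num * n := by
      have h4 : x * r.den = r.num * y := by
        rw [hxr]
        field_simp
      rw [hm, hn] at h4
      have h5 : ((m : ℝ) * r.den) = r.num * n := by
        apply mul_right_cancel₀ hd.ne'
        linarith
      exact_mod_cast h5
    have h6 : (r.den : ℤ) ∣ n := by
      have hc : IsCoprime (r.den : ℤ) r.num := by
        rw [Int.isCoprime_iff_gcd_eq_one, Int.gcd_comm]
        exact r.reduced
      exact hc.dvd_of_dvd_mul_left ⟨m, by rw [← h3]; ring⟩
    have h7 : (r.den : ℤ) ≤ |n| := Int.le_of_dvd (abs_pos.mpr hn0) ((dvd_abs _ _).mpr h6)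
    have h8 : (r.den : ℝ) ≤ |(n : ℝ)| := by exact_mod_cast h7
    rw [le_div_iff₀ hden, hn, abs_mul, abs_of_pos hd, mul_comm]
    exact mul_le_mul_of_nonneg_right h8 hd.le

/-- The `k`-th Fourier coefficient `Γ(1 - 2πik/d) / (1 + 2πik/d)` of the oscillating term. -/
noncomputable def trieFourierCoeff (d : ℝ) (k : ℤ) : ℂ :=
  Complex.Gamma (1 - 2 * Real.pi * Complex.I * k / d) / (1 + 2 * Real.pi * Complex.I * k / d)

/-! A word α labels an internal node exactly when at least two strings begin with α. Letters being
independent, the number of such strings is binomial or Poisson, so both expectations are sums over α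
of tail probabilities of being at least 2. They are finite because these tails are quadratic in the
word probability P(α), and ∑ P(α)² < ∞.

Let u(t) be the Poisson expectation divided by λ = e^t (`meanSize`). Splitting words by their first
letter gives the renewal equation u(t) = g(t) + p u(t - a) + q u(t - b), with a = -ln p, b = -ln q,
g = `rootTerm`. Two facts determine u at infinity. Conservation: p∫_{t-a}^t u + q∫_{t-b}^t u has
derivative g and vanishes at -∞, so it is the integral of g up to t and tends to 1
(`renewalAverage_meanSize`); this also bounds u. Rigidity: a Choquet-Deny argument
(`eventually_sub_lt`) shows that a and b are asymptotic periods of u, and such periods form a group,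
closed since u is uniformly continuous.

If a/b is irrational, every shift is an asymptotic period, the conserved average is asymptotically
(pa + qb)u = Hu, and u → 1/H. Otherwise a = Ad and b = Bd with A, B coprime, d is an asymptotic
period, and a telescoping discrete average gives Hu(t) - d∑_k g(t - kd) → 0. Poisson summation
expands the periodized g; its coefficients are values of the Fourier transform of g, obtained from
the Gamma integral (`integral_exp_mul_rootTerm`).

For fixed n, the binomial and Poisson tails differ by at most C n P(α)², and dominated convergence
over the words makes the two normalized means asymptotically equal. -/

/-! ### Words, prefixes and internal nodes -/

/-- The string `s` begins with the finite word `α`. -/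
def HasPrefix : List Bool → BinString → Prop
  | [], _ => True
  | b :: α, s => s 0 = b ∧ HasPrefix α (fun i => s (i + 1))

theorem hasPrefix_iff (α : List Bool) (s : BinString) :
    HasPrefix α s ↔ ∀ i < α.length, s i = α.getD i false := by
  induction α generalizing s with
  | nil => simp [HasPrefix]
  | cons b α ih =>
    rw [HasPrefix, ih]
    constructor
    · rintro ⟨h0, h⟩ (_ | i) hi
      · simpa using h0
      · simpa using h i (by simpa using hi)
    · intro h
      exact ⟨by simpa using h 0 (by simp), fun i hi => by simpa using h (i + 1) (by simpa using hi)⟩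

theorem measurableSet_hasPrefix (α : List Bool) : MeasurableSet {s : BinString | HasPrefix α s} := by
  have h : {s : BinString | HasPrefix α s} =
      ⋂ i ∈ Finset.range α.length, {s : BinString | s i = α.getD i false} := by
    ext s
    simp [hasPrefix_iff]
  rw [h]
  exact Finset.measurableSet_biInter _ fun i _ => measurable_pi_apply i (measurableSet_singleton _)

/-- At least two of the strings of `S` begin with `α`. -/
def SharedPrefix (S : Finset BinString) (α : List Bool) : Prop :=
  ∃ s ∈ S, ∃ t ∈ S, s ≠ t ∧ HasPrefix α s ∧ HasPrefix α t

theorem sharedPrefix_nil (S : Finset BinString) : SharedPrefix S [] ↔ 2 ≤ S.card := by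
  simp only [SharedPrefix, HasPrefix, and_true, Nat.succ_le_iff]
  exact Finset.one_lt_card.symm

theorem sharedPrefix_branch (S : Finset BinString) (b : Bool) (α : List Bool) :
    SharedPrefix (BinaryTrie.branch S b) α ↔ SharedPrefix S (b :: α) := by
  classical
  simp only [SharedPrefix, BinaryTrie.branch, Finset.mem_image, Finset.mem_filter, HasPrefix]
  constructor
  · rintro ⟨_, ⟨s, ⟨hs, hsb⟩, rfl⟩, _, ⟨t, ⟨ht, htb⟩, rfl⟩, hst, hs', ht'⟩
    exact ⟨s, hs, t, ht, fun h => hst (by rw [h]), ⟨hsb, hs'⟩, htb, ht'⟩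
  · rintro ⟨s, hs, t, ht, hst, ⟨hsb, hs'⟩, htb, ht'⟩
    refine ⟨_, ⟨s, ⟨hs, hsb⟩, rfl⟩, _, ⟨t, ⟨ht, htb⟩, rfl⟩, fun h => hst ?_, hs', ht'⟩
    ext (_ | i)
    · rw [hsb, htb]
    · exact congrFun h i

/-- A word is empty or consists of a letter and a word. -/
def wordEquiv : List Bool ≃ Unit ⊕ (List Bool ⊕ List Bool) where
  toFun
    | [] => .inl ()
    | false :: α => .inr (.inl α)
    | true :: α => .inr (.inr α)
  invFun
    | .inl _ => []
    | .inr (.inl α) => false :: α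
    | .inr (.inr α) => true :: α
  left_inv := by rintro (_ | ⟨_ | _, α⟩) <;> rfl
  right_inv := by rintro (_ | _ | _) <;> rfl

/-- Decomposition by the first letter. It yields the recursion for the trie, the geometric bound on
∑ P(α)² and the renewal equation. -/
theorem tsum_word {M : Type*} [AddCommMonoid M] [TopologicalSpace M] [ContinuousAdd M] [T3Space M]
    (f : List Bool → M) (h0 : Summable fun α => f (false :: α))
    (h1 : Summable fun α => f (true :: α)) :
    ∑' α, f α = f [] + (∑' α, f (false :: α) + ∑' α, f (true :: α)) := by
  have e0 : HasSum (fun x : Unit => f (wordEquiv.symm (.inl x))) (f []) := hasSum_unique _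
  have e1 : HasSum (fun x => f (wordEquiv.symm (.inr x)))
      (∑' α, f (false :: α) + ∑' α, f (true :: α)) :=
    HasSum.sum (f := fun x => f (wordEquiv.symm (.inr x))) h0.hasSum h1.hasSum
  have e2 := HasSum.sum (f := fun x => f (wordEquiv.symm x)) e0 e1
  exact ((Equiv.hasSum_iff wordEquiv.symm (f := f)).mp e2).tsum_eq

open scoped Classical ENNReal in
/-- The internal nodes correspond to the words that are prefixes of at least two strings. -/
theorem numInternal_ofStrings (S : Finset BinString) :
    ((BinaryTrie.ofStrings S).numInternal : ℝ≥0∞) =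
      ∑' α, if SharedPrefix S α then 1 else 0 := by
  induction hk : BinaryTrie.sepDepth S using Nat.strong_induction_on generalizing S with
  | _ k ih =>
    subst hk
    by_cases h : 2 ≤ S.card
    · rw [BinaryTrie.ofStrings, dif_pos h, BinaryTrie.numInternal,
        tsum_word _ ENNReal.summable ENNReal.summable, if_pos ((sharedPrefix_nil S).mpr h)]
      simp only [← sharedPrefix_branch]
      rw [← ih _ (BinaryTrie.sepDepth_branch_lt S false h) _ rfl,
        ← ih _ (BinaryTrie.sepDepth_branch_lt S true h) _ rfl]
      push_cast
      ring
    · have h0 : (BinaryTrie.ofStrings S).numInternal = 0 := by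
        rw [BinaryTrie.ofStrings, dif_neg h]
        split <;> rfl
      have h1 : ∀ α, ¬ SharedPrefix S α := by
        rintro α ⟨s, hs, t, ht, hst, -⟩
        exact h (Finset.one_lt_card.mpr ⟨s, hs, t, ht, hst⟩)
      simp [h0, h1]

open scoped Classical ENNReal in
-- A countable sum of indicators makes the size measurable. The condition is `x i ≠ x j` and not `i
-- ≠ j`, because repeated strings collapse in the set from which the trie is built.
theorem trieSize_eq_tsum (x : ℕ → BinString) (n : ℕ) :
    (trieSize x n : ℝ≥0∞) = ∑' α, Set.indicator
      {x : ℕ → BinString | ∃ i < n, ∃ j < n, x i ≠ x j ∧ HasPrefix α (x i) ∧ HasPrefix α (x j)}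
      1 x := by
  rw [trieSize, numInternal_ofStrings]
  refine tsum_congr fun α => ?_
  simp [Set.indicator_apply, SharedPrefix]

theorem measurable_trieSize (n : ℕ) :
    Measurable fun x : ℕ → BinString => (trieSize x n : ENNReal) := by
  simp only [trieSize_eq_tsum]
  refine Measurable.tsum fun α => ?_
  refine measurable_one.indicator ?_
  simp only [Set.ofPred_exists, Set.ofPred_and]
  refine MeasurableSet.iUnion fun i => (MeasurableSet.const _).inter <|
    MeasurableSet.iUnion fun j => (MeasurableSet.const _).inter <| MeasurableSet.inter ?_ ?_
  · exact (measurableSet_eq_fun (measurable_pi_apply i) (measurable_pi_apply j)).compl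
  · exact (measurable_pi_apply i (measurableSet_hasPrefix α)).inter
      (measurable_pi_apply j (measurableSet_hasPrefix α))

/-! ### Word probabilities and the binomial and Poisson tails -/

/-- The probability that a random string begins with `α`. -/
noncomputable def wordProb (p : ℝ) : List Bool → ℝ
  | [] => 1
  | b :: α => (if b then p else 1 - p) * wordProb p α

/-- `P(X ≥ 2)` for a binomial `X` with parameters `n` and `x`. -/
noncomputable def binomTail (n : ℕ) (x : ℝ) : ℝ := 1 - (1 - x) ^ n - n * x * (1 - x) ^ (n - 1)

/-- `P(X ≥ 2)` for a Poisson variable `X` with mean `x`. -/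
noncomputable def poissonTail (x : ℝ) : ℝ := 1 - (1 + x) * Real.exp (-x)

theorem wordProb_pos {p : ℝ} (hp0 : 0 < p) (hp1 : p < 1) (α : List Bool) : 0 < wordProb p α := by
  induction α with
  | nil => simp [wordProb]
  | cons b α ih =>
    have : 0 < 1 - p := by linarith
    cases b <;> simp only [wordProb, if_true, Bool.false_eq_true, if_false] <;> positivity

theorem wordProb_le_one {p : ℝ} (hp0 : 0 < p) (hp1 : p < 1) (α : List Bool) :
    wordProb p α ≤ 1 := by
  induction α with
  | nil => simp [wordProb]
  | cons b α ih =>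
    have := (wordProb_pos hp0 hp1 α).le
    cases b <;> simp only [wordProb, if_true, Bool.false_eq_true, if_false] <;> nlinarith

open scoped ENNReal Classical in
-- With r = p² + (1 - p)² < 1, the sum f n over words shorter than n satisfies f (n + 1) = 1 + r f
-- n, so it stays below the fixed point 1 / (1 - r).
theorem tsum_wordProb_sq_ne_top {p : ℝ} (hp0 : 0 < p) (hp1 : p < 1) :
    ∑' α, ENNReal.ofReal (wordProb p α ^ 2) ≠ ∞ := by
  set r := p ^ 2 + (1 - p) ^ 2 with hr
  have hr0 : 0 ≤ r := by positivity
  have hr1 : r < 1 := by nlinarith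
  have h1r : 0 < 1 - r := by linarith
  let f : ℕ → ℝ≥0∞ := fun n =>
    ∑' α : List Bool, if α.length < n then ENNReal.ofReal (wordProb p α ^ 2) else 0
  have hf : ∀ n, f n ≤ ENNReal.ofReal (1 / (1 - r)) := by
    intro n
    induction n with
    | zero => simp [f]
    | succ n ih =>
      have e : ∀ b, (∑' α : List Bool, if (b :: α).length < n + 1 then
          ENNReal.ofReal (wordProb p (b :: α) ^ 2) else 0) =
          ENNReal.ofReal ((if b then p else 1 - p) ^ 2) * f n := by
        intro b
        rw [← ENNReal.tsum_mul_left]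
        refine tsum_congr fun α => ?_
        simp only [List.length_cons, Nat.add_lt_add_iff_right, wordProb, mul_pow]
        rw [ENNReal.ofReal_mul (by positivity)]
        split <;> simp
      have e1 : f (n + 1) = 1 + ENNReal.ofReal r * f n := by
        simp only [f]
        rw [tsum_word _ ENNReal.summable ENNReal.summable, e, e, ← add_mul,
          ← ENNReal.ofReal_add (by positivity) (by positivity)]
        simp only [wordProb, Bool.false_eq_true, if_true, if_false, hr, List.length_nil,
          Nat.succ_pos, one_pow, ENNReal.ofReal_one]
        rw [add_comm (p ^ 2)]
      calc f (n + 1) ≤ 1 + ENNReal.ofReal r * ENNReal.ofReal (1 / (1 - r)) := by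
            rw [e1]; gcongr
        _ = ENNReal.ofReal (1 / (1 - r)) := by
            rw [← ENNReal.ofReal_mul hr0, ← ENNReal.ofReal_one,
              ← ENNReal.ofReal_add zero_le_one (by positivity)]
            congr 1
            field_simp
            ring
  refine ne_top_of_le_ne_top ENNReal.ofReal_ne_top (b := ENNReal.ofReal (1 / (1 - r))) ?_
  -- Any finite set of words is contained in one of the truncations by length.
  rw [ENNReal.tsum_eq_iSup_sum]
  refine iSup_le fun u => le_trans ?_ (hf (u.sup List.length + 1))
  refine le_trans (Finset.sum_le_sum fun α hα => ?_) (ENNReal.sum_le_tsum u)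
  rw [if_pos (Nat.lt_succ_of_le (Finset.le_sup (f := List.length) hα))]

theorem summable_wordProb_sq {p : ℝ} (hp0 : 0 < p) (hp1 : p < 1) :
    Summable fun α => wordProb p α ^ 2 := by
  have h := ENNReal.summable_toReal (tsum_wordProb_sq_ne_top hp0 hp1)
  simpa only [ENNReal.toReal_ofReal (sq_nonneg _)] using h

/-- Among `n` independent events of probability `x`, at least two occur with the binomial
probability. -/
theorem measureReal_two_of_iIndepSet {Ω : Type*} [MeasurableSpace Ω] {P : Measure Ω}
    [IsProbabilityMeasure P] {A : ℕ → Set Ω} (hA : ∀ i, MeasurableSet (A i)) (hi : iIndepSet A P)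
    {x : ℝ} (hx : ∀ i, P.real (A i) = x) (n : ℕ) :
    P.real {ω | ∃ i < n, ∃ j < n, i ≠ j ∧ ω ∈ A i ∧ ω ∈ A j} = binomTail n x := by
  classical
  have hxc : ∀ i, P.real (A i)ᶜ = 1 - x := fun i => by rw [probReal_compl_eq_one_sub (hA i), hx]
  have hprod : ∀ (s : Finset ℕ) (k : Option ℕ),
      P.real (⋂ i ∈ s, if some i = k then A i else (A i)ᶜ) =
        ∏ i ∈ s, if some i = k then x else 1 - x := by
    intro s k
    have := (iIndepSet_iff A P).mp hi s (f := fun i => if some i = k then A i else (A i)ᶜ) (by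
      intro i _
      have hm : MeasurableSet[MeasurableSpace.generateFrom {A i}] (A i) :=
        MeasurableSpace.measurableSet_generateFrom rfl
      split
      exacts [hm, hm.compl])
    rw [measureReal_def, this, ENNReal.toReal_prod]
    refine Finset.prod_congr rfl fun i _ => ?_
    rw [← measureReal_def]
    split
    exacts [hx i, hxc i]
  -- `E none`: none of the first n events occurs; `E (some k)`: exactly the k-th does. These
  -- disjoint events make up the complement of "at least two occur".
  let E : Option ℕ → Set Ω := fun k =>
    ⋂ i ∈ Finset.range n, if some i = k then A i else (A i)ᶜ
  have hE : ∀ k ω, ω ∈ E k ↔ ∀ i < n, (ω ∈ A i ↔ some i = k) := by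
    intro k ω
    simp only [E, Set.mem_iInter, Finset.mem_range]
    refine forall₂_congr fun i _ => ?_
    split <;> simp_all
  have hEm : ∀ k, MeasurableSet (E k) := fun k => Finset.measurableSet_biInter _ fun i _ => by
    split
    exacts [hA i, (hA i).compl]
  let K : Finset (Option ℕ) := insert none ((Finset.range n).image some)
  have hset : {ω | ∃ i < n, ∃ j < n, i ≠ j ∧ ω ∈ A i ∧ ω ∈ A j}ᶜ = ⋃ k ∈ K, E k := by
    ext ω
    simp only [Set.mem_compl_iff, Set.mem_ofPred_eq, Set.mem_iUnion, exists_prop, hE]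
    constructor
    · intro h
      by_cases h1 : ∃ k < n, ω ∈ A k
      · obtain ⟨k, hk, hkA⟩ := h1
        refine ⟨some k, by simp [K, hk], fun i hin => ⟨fun hiA => ?_, fun hik => ?_⟩⟩
        · by_contra hne
          exact h ⟨i, hin, k, hk, fun h => hne (by rw [h]), hiA, hkA⟩
        · rwa [Option.some.inj hik]
      · push Not at h1
        exact ⟨none, by simp [K], fun i hin => by simp [h1 i hin]⟩
    · rintro ⟨k, -, hk⟩ ⟨i, hi, j, hj, hij, hiA, hjA⟩
      exact hij (Option.some.inj (((hk i hi).mp hiA).trans ((hk j hj).mp hjA).symm))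
  have hdisj : Set.PairwiseDisjoint (K : Set (Option ℕ)) E := by
    intro k hk k' hk' hne
    refine Set.disjoint_left.mpr fun ω h h' => hne ?_
    rw [hE] at h h'
    have hb : ∀ k ∈ K, ∀ k', (∀ i < n, some i = k ↔ some i = k') → k ≠ none → k = k' := by
      intro k hk k' hkk hkn
      obtain ⟨i, rfl⟩ := Option.ne_none_iff_exists'.mp hkn
      exact (hkk i (by simpa [K] using hk)).mp rfl
    have hkk : ∀ i < n, some i = k ↔ some i = k' := fun i hi => (h i hi).symm.trans (h' i hi)
    by_cases hkn : k = none
    · by_cases hkn' : k' = none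
      · rw [hkn, hkn']
      · exact (hb k' hk' k (fun i hi => (hkk i hi).symm) hkn').symm
    · exact hb k hk k' hkk hkn
  have hm : MeasurableSet {ω | ∃ i < n, ∃ j < n, i ≠ j ∧ ω ∈ A i ∧ ω ∈ A j} := by
    rw [← MeasurableSet.compl_iff, hset]
    exact Finset.measurableSet_biUnion _ fun k _ => hEm k
  have h1 := probReal_compl_eq_one_sub (μ := P) hm
  rw [hset, measureReal_biUnion_finset hdisj (fun k _ => hEm k),
    Finset.sum_insert (by simp), Finset.sum_image (fun _ _ _ _ h => Option.some.inj h)] at h1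
  simp only [E, hprod] at h1
  have h2 : ∀ k ∈ Finset.range n, (∏ i ∈ Finset.range n, if some i = some k then x else 1 - x) =
      x * (1 - x) ^ (n - 1) := by
    intro k hk
    rw [← Finset.mul_prod_erase _ _ hk, if_pos rfl,
      Finset.prod_congr rfl (g := fun _ => 1 - x)
        (fun i hi => if_neg fun h => (Finset.mem_erase.mp hi).1 (Option.some.inj h)),
      Finset.prod_const, Finset.card_erase_of_mem hk, Finset.card_range]
  rw [Finset.sum_congr rfl h2] at h1
  simp only [reduceCtorEq, if_false, Finset.prod_const, Finset.card_range, Finset.sum_const,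
    nsmul_eq_mul] at h1
  rw [binomTail]
  linarith

/-- Bernoulli's inequality for both powers leaves n x · (n - 1) x. -/
theorem binomTail_le (n : ℕ) {x : ℝ} (hx0 : 0 ≤ x) (hx1 : x ≤ 1) :
    binomTail n x ≤ n ^ 2 * x ^ 2 := by
  have h1 := one_add_mul_le_pow (a := -x) (by linarith) n
  have h2 := one_add_mul_le_pow (a := -x) (by linarith) (n - 1)
  have h3 : ((n - 1 : ℕ) : ℝ) ≤ n := by exact_mod_cast Nat.sub_le n 1
  rw [← sub_eq_add_neg] at h1 h2
  have h4 : (0 : ℝ) ≤ n * x := by positivity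
  rw [binomTail]
  nlinarith [mul_le_mul_of_nonneg_left h2 h4, mul_le_mul_of_nonneg_right h3 hx0]

theorem binomTail_nonneg (n : ℕ) {x : ℝ} (hx1 : x ≤ 1) : 0 ≤ binomTail n x := by
  induction n with
  | zero => simp [binomTail]
  | succ n ih =>
    -- The increment is the probability that the second success comes at trial n + 1.
    have h : binomTail (n + 1) x = binomTail n x + n * x ^ 2 * (1 - x) ^ (n - 1) := by
      cases n <;> simp [binomTail]
      ring
    have : 0 ≤ 1 - x := by linarith
    rw [h]
    positivity

/-- Poisson thinning: keeping each of Po(l) points with probability x leaves Po(l x) points.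
Analytically, exponential series at l and l (1 - x). -/
theorem hasSum_poisson_binomTail (l x : ℝ) :
    HasSum (fun n : ℕ => Real.exp (-l) * l ^ n / n.factorial * binomTail n x)
      (poissonTail (l * x)) := by
  have hexp : ∀ y : ℝ, HasSum (fun n : ℕ => Real.exp (-l) * (y ^ n / n.factorial))
      (Real.exp (-l) * Real.exp y) := fun y => by
    rw [Real.exp_eq_exp_ℝ]
    exact (NormedSpace.expSeries_div_hasSum_exp y).mul_left _
  have h1 := hexp l
  have h2 := hexp (l * (1 - x))
  have h3 : HasSum (fun n : ℕ => Real.exp (-l) * l ^ n / n.factorial *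
      (n * x * (1 - x) ^ (n - 1))) (l * x * (Real.exp (-l) * Real.exp (l * (1 - x)))) := by
    -- The term n = 0 vanishes through its factor n; after the shift this factor cancels against the
    -- factorial and the truncated n - 1 becomes harmless.
    rw [← hasSum_nat_add_iff' 1]
    simp only [Finset.range_one, Finset.sum_singleton, Nat.cast_zero, zero_mul, mul_zero, sub_zero]
    convert! h2.mul_left (l * x) using 1
    funext n
    rw [Nat.factorial_succ, Nat.add_sub_cancel, mul_pow]
    push_cast
    field_simp
    ring
  convert! (h1.sub h2).sub h3 using 1
  · funext n
    rw [binomTail, mul_pow]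
    ring
  · rw [poissonTail, ← Real.exp_add, ← Real.exp_add, show -l + l = 0 by ring,
      show -l + l * (1 - x) = -(l * x) by ring, Real.exp_zero]
    ring

/-! ### Expected size of the trie as a sum over words -/

/-- A random string has the prefix `α` with probability `wordProb p α`, independently for
different strings. -/
theorem measure_biInter_hasPrefix {Ω : Type*} [MeasurableSpace Ω] {P : Measure Ω}
    [IsProbabilityMeasure P] {p : ℝ} (hp0 : 0 < p) (hp1 : p < 1) {ξ : ℕ → ℕ → Ω → Bool}
    (hξ_meas : ∀ j i, Measurable (ξ j i))
    (hξ_indep : iIndepFun (fun ji : ℕ × ℕ => ξ ji.1 ji.2) P)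
    (hξ_law : ∀ j i, P {ω | ξ j i ω = true} = ENNReal.ofReal p) (α : List Bool) (S : Finset ℕ) :
    P (⋂ j ∈ S, {ω | HasPrefix α fun i => ξ j i ω}) =
      ∏ _j ∈ S, ENNReal.ofReal (wordProb p α) := by
  have hlaw : ∀ j i b, P (ξ j i ⁻¹' {b}) = ENNReal.ofReal (if b then p else 1 - p) := by
    intro j i b
    cases b
    · have h1 : ξ j i ⁻¹' {false} = {ω | ξ j i ω = true}ᶜ := by
        ext ω
        simp
      have h2 : MeasurableSet {ω | ξ j i ω = true} := hξ_meas j i (measurableSet_singleton true)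
      rw [h1, prob_compl_eq_one_sub h2, hξ_law,
        ← ENNReal.ofReal_one, ← ENNReal.ofReal_sub _ hp0.le]
      simp
    · exact hξ_law j i
  have hset : (⋂ j ∈ S, {ω | HasPrefix α fun i => ξ j i ω}) =
      ⋂ ji ∈ S ×ˢ Finset.range α.length, ξ ji.1 ji.2 ⁻¹' {α.getD ji.2 false} := by
    ext ω
    simp only [hasPrefix_iff, Set.mem_iInter, Set.mem_ofPred_eq, Finset.mem_product,
      Finset.mem_range, Set.mem_preimage, Set.mem_singleton_iff, Prod.forall]
    exact ⟨fun h j i hji => h j hji.1 i hji.2, fun h j hj i hi => h j i ⟨hj, hi⟩⟩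
  have hword : ∀ α : List Bool, ∏ i ∈ Finset.range α.length,
      ENNReal.ofReal (if α.getD i false then p else 1 - p) = ENNReal.ofReal (wordProb p α) := by
    intro α
    induction α with
    | nil => simp [wordProb]
    | cons b α ih =>
      have h1 : 0 ≤ if b then p else 1 - p := by split <;> linarith
      rw [List.length_cons, Finset.prod_range_succ', wordProb, ENNReal.ofReal_mul h1, ← ih,
        mul_comm]
      simp
  rw [hset, hξ_indep.measure_inter_preimage_eq_mul (S ×ˢ Finset.range α.length)
    (sets := fun ji => {α.getD ji.2 false}) fun ji _ => measurableSet_singleton _,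
    Finset.prod_product]
  simp only [hlaw, hword]

section RandomTrie

variable {Ω : Type*} [MeasurableSpace Ω] {P : Measure Ω} [IsProbabilityMeasure P]
  {p : ℝ} (hp0 : 0 < p) (hp1 : p < 1) {ξ : ℕ → ℕ → Ω → Bool}
  (hξ_meas : ∀ j i, Measurable (ξ j i))
  (hξ_indep : iIndepFun (fun ji : ℕ × ℕ => ξ ji.1 ji.2) P)
  (hξ_law : ∀ j i, P {ω | ξ j i ω = true} = ENNReal.ofReal p)
include hp0 hp1 hξ_meas hξ_indep hξ_law

theorem iIndepSet_hasPrefix (α : List Bool) :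
    iIndepSet (fun j => {ω | HasPrefix α fun i => ξ j i ω}) P := by
  have hm : ∀ j, MeasurableSet {ω | HasPrefix α fun i => ξ j i ω} := fun j =>
    measurable_pi_lambda (fun ω i => ξ j i ω) (fun i => hξ_meas j i) (measurableSet_hasPrefix α)
  rw [iIndepSet_iff_meas_biInter hm]
  intro S
  rw [measure_biInter_hasPrefix hp0 hp1 hξ_meas hξ_indep hξ_law]
  refine Finset.prod_congr rfl fun j _ => ?_
  simpa using (measure_biInter_hasPrefix hp0 hp1 hξ_meas hξ_indep hξ_law α {j}).symm

/-- Borel-Cantelli: two given strings both begin with α with probability P(α)², which is summable,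
whereas equal strings share infinitely many prefixes. -/
theorem ae_strings_ne {j k : ℕ} (hjk : j ≠ k) :
    ∀ᵐ ω ∂P, (fun i => ξ j i ω) ≠ fun i => ξ k i ω := by
  let B : List Bool → Set Ω := fun α =>
    ⋂ m ∈ ({j, k} : Finset ℕ), {ω | HasPrefix α fun i => ξ m i ω}
  have hB : ∑' α, P (B α) ≠ ⊤ := by
    convert! tsum_wordProb_sq_ne_top hp0 hp1 using 3 with α
    rw [measure_biInter_hasPrefix hp0 hp1 hξ_meas hξ_indep hξ_law, Finset.prod_const,
      Finset.card_pair hjk, ENNReal.ofReal_pow (wordProb_pos hp0 hp1 α).le]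
  refine measure_mono_null (fun ω hω => ?_) (measure_limsup_cofinite_eq_zero hB)
  have heq : (fun i => ξ j i ω) = fun i => ξ k i ω := by simpa using hω
  rw [Filter.cofinite.mem_limsup_iff_frequently_mem]
  have hinj : Function.Injective fun n : ℕ => List.ofFn fun i : Fin n => ξ j i ω := by
    intro m n h
    simpa using congrArg List.length h
  refine hinj.tendsto_cofinite.frequently (Frequently.of_forall fun n => ?_)
  have hpre : HasPrefix (List.ofFn fun i : Fin n => ξ j i ω) fun i => ξ j i ω := by
    rw [hasPrefix_iff]
    intro i hi
    simp at hi
    simp [hi]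
  simp only [B, Set.mem_iInter, Finset.mem_insert, Finset.mem_singleton, Set.mem_ofPred_eq]
  rintro m (rfl | rfl)
  · exact hpre
  · rwa [← heq]

/-- Almost surely the strings are distinct, so distinct strings may be replaced by distinct indices;
each word then contributes a binomial tail. -/
theorem lintegral_trieSize (n : ℕ) :
    ∫⁻ ω, (trieSize (fun j i => ξ j i ω) n : ENNReal) ∂P =
      ∑' α, ENNReal.ofReal (binomTail n (wordProb p α)) := by
  have hX : Measurable fun ω j i => ξ j i ω :=
    measurable_pi_lambda _ fun j => measurable_pi_lambda _ fun i => hξ_meas j i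
  have hm : ∀ α j, MeasurableSet {ω | HasPrefix α fun i => ξ j i ω} := fun α j =>
    measurable_pi_lambda (fun ω i => ξ j i ω) (fun i => hξ_meas j i) (measurableSet_hasPrefix α)
  let A : List Bool → Set Ω := fun α => {ω | ∃ i < n, ∃ j < n, i ≠ j ∧
    ω ∈ {ω | HasPrefix α fun m => ξ i m ω} ∧ ω ∈ {ω | HasPrefix α fun m => ξ j m ω}}
  have hA : ∀ α, MeasurableSet (A α) := by
    intro α
    simp only [A, Set.ofPred_exists, Set.ofPred_and]
    exact MeasurableSet.iUnion fun i => (MeasurableSet.const _).inter <|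
      MeasurableSet.iUnion fun j => (MeasurableSet.const _).inter <|
        (MeasurableSet.const _).inter ((hm α i).inter (hm α j))
  have hae : ∀ᵐ ω ∂P, (trieSize (fun j i => ξ j i ω) n : ENNReal) =
      ∑' α, (A α).indicator 1 ω := by
    have hne : ∀ᵐ ω ∂P, ∀ j k : ℕ, j ≠ k → (fun i => ξ j i ω) ≠ fun i => ξ k i ω := by
      simp only [ae_all_iff]
      exact fun j k hjk => ae_strings_ne hp0 hp1 hξ_meas hξ_indep hξ_law hjk
    filter_upwards [hne] with ω hω
    rw [trieSize_eq_tsum]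
    refine tsum_congr fun α => ?_
    refine Set.indicator_eq_indicator ?_ rfl
    refine exists_congr fun i => and_congr_right fun _ => exists_congr fun j =>
      and_congr_right fun _ => and_congr_left fun _ => ⟨?_, hω i j⟩
    rintro h rfl
    exact h rfl
  rw [lintegral_congr_ae hae, lintegral_tsum fun α =>
    (measurable_one.indicator (hA α)).aemeasurable]
  refine tsum_congr fun α => ?_
  have hx : ∀ j, P.real {ω | HasPrefix α fun i => ξ j i ω} = wordProb p α := by
    intro j
    have := measure_biInter_hasPrefix hp0 hp1 hξ_meas hξ_indep hξ_law α {j}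
    simp only [Finset.mem_singleton, Set.iInter_iInter_eq_left, Finset.prod_singleton] at this
    rw [measureReal_def, this, ENNReal.toReal_ofReal (wordProb_pos hp0 hp1 α).le]
  rw [← measureReal_two_of_iIndepSet (hm α)
    (iIndepSet_hasPrefix hp0 hp1 hξ_meas hξ_indep hξ_law α) hx n, ofReal_measureReal,
    lintegral_indicator_one (hA α)]

/-- Independence turns the joint law into a product; integrating over the strings at fixed `N` and
exchanging the sums reduces the claim to thinning, word by word. -/
theorem lintegral_trieSize_poisson {N : Ω → ℕ} {l : ℝ≥0} (hN_meas : Measurable N)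
    (hN_law : P.map N = poissonMeasure l) (hN_indep : IndepFun N (fun ω j i => ξ j i ω) P) :
    ∫⁻ ω, (trieSize (fun j i => ξ j i ω) (N ω) : ENNReal) ∂P =
      ∑' α, ENNReal.ofReal (poissonTail (l * wordProb p α)) := by
  have hX : Measurable fun ω j i => ξ j i ω :=
    measurable_pi_lambda _ fun j => measurable_pi_lambda _ fun i => hξ_meas j i
  have hF : Measurable fun y : ℕ × (ℕ → BinString) => (trieSize y.2 y.1 : ENNReal) :=
    measurable_from_prod_countable_right measurable_trieSize
  have := Measure.isProbabilityMeasure_map (μ := P) hX.aemeasurable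
  have h1 := lintegral_map (μ := P) hF (hN_meas.prodMk hX)
  rw [← h1, (indepFun_iff_map_prod_eq_prod_map_map hN_meas.aemeasurable hX.aemeasurable).mp
    hN_indep, lintegral_prod _ hF.aemeasurable, hN_law, lintegral_countable']
  have h2 : ∀ n, ∫⁻ x, (trieSize x n : ENNReal) ∂(P.map fun ω j i => ξ j i ω) =
      ∑' α, ENNReal.ofReal (binomTail n (wordProb p α)) := fun n => by
    rw [lintegral_map (measurable_trieSize n) hX,
      lintegral_trieSize hp0 hp1 hξ_meas hξ_indep hξ_law]
  simp only [h2, poissonMeasure_singleton]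
  simp only [mul_comm _ (ENNReal.ofReal (Real.exp _ * _ / _)), ← ENNReal.tsum_mul_left]
  rw [ENNReal.tsum_comm]
  refine tsum_congr fun α => ?_
  have h3 := hasSum_poisson_binomTail l (wordProb p α)
  rw [← h3.tsum_eq, ENNReal.ofReal_tsum_of_nonneg (fun n => mul_nonneg (by positivity) (binomTail_nonneg n
    (wordProb_le_one hp0 hp1 α)))
    h3.summable]
  refine tsum_congr fun n => ?_
  rw [ENNReal.ofReal_mul (by positivity)]

end RandomTrie

/-! ### The renewal theorem for a walk with two steps -/

section Renewal

/-- One half of the Choquet-Deny argument: the differences of a bounded asymptotic solution of the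
renewal equation are asymptotically nonpositive. -/
theorem eventually_sub_lt {p q a b M : ℝ} (hp : 0 < p) (hq : 0 ≤ q) (hpq : p + q = 1)
    {u : ℝ → ℝ} (hM : ∀ t, |u t| ≤ M)
    (hr : Tendsto (fun t => u t - p * u (t - a) - q * u (t - b)) atTop (𝓝 0)) {δ : ℝ}
    (hδ : 0 < δ) : ∀ᶠ t in atTop, u t - u (t - a) < δ := by
  set z : ℝ → ℝ := fun t => u t - u (t - a) with hz
  have hzM : ∀ t, |z t| ≤ 2 * M := fun t => by
    have := abs_sub (u t) (u (t - a))
    linarith [hM t, hM (t - a)]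
  have hbd : IsBoundedUnder (· ≤ ·) atTop z :=
    isBoundedUnder_of ⟨2 * M, fun t => (abs_le.mp (hzM t)).2⟩
  have hbd' : IsBoundedUnder (· ≥ ·) atTop z :=
    isBoundedUnder_of ⟨-(2 * M), fun t => (abs_le.mp (hzM t)).1⟩
  -- The differences z satisfy the same equation with an error ρ → 0. Along an ultrafilter on which
  -- z(t) → D, a convex combination of values asymptotically at most D tends to D, so z(t - a) → D
  -- as well, and inductively z(t - k a) → D. Summing K of these telescopes to a difference of
  -- values of u, hence K D ≤ 2 M for all K.
  set D := limsup z atTop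
  suffices hD0 : D ≤ 0 from eventually_lt_of_limsup_lt (lt_of_le_of_lt hD0 hδ) hbd
  have hup : ∀ η > 0, ∀ᶠ t in atTop, z t < D + η := fun η hη =>
    eventually_lt_of_limsup_lt (by linarith) hbd
  have hcl : MapClusterPt D atTop z := by
    rw [mapClusterPt_iff_frequently]
    intro s hs
    obtain ⟨η, hη, hball⟩ := Metric.mem_nhds_iff.mp hs
    have h1 : ∃ᶠ t in atTop, D - η < z t :=
      frequently_lt_of_lt_limsup hbd'.isCoboundedUnder_le (by linarith)
    refine (h1.and_eventually (hup η hη)).mono fun t ht => hball ?_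
    rw [Metric.mem_ball, Real.dist_eq, abs_lt]
    constructor <;> linarith [ht.1, ht.2]
  obtain ⟨U, hU, hzU⟩ := mapClusterPt_iff_ultrafilter.mp hcl
  have htend : ∀ c : ℝ, Tendsto (fun t => t - c) (U : Filter ℝ) atTop := fun c =>
    (tendsto_atTop_add_const_right _ (-c) tendsto_id).mono_left hU
  obtain ⟨ρ, hrz, hρ⟩ : ∃ ρ : ℝ → ℝ, (∀ t, z t = p * z (t - a) + q * z (t - b) + ρ t) ∧
      Tendsto ρ atTop (𝓝 0) := by
    refine ⟨fun t => (u t - p * u (t - a) - q * u (t - b)) -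
        (u (t - a) - p * u (t - a - a) - q * u (t - a - b)), fun t => ?_, ?_⟩
    · simp only [hz]
      rw [show t - b - a = t - a - b by ring]
      ring
    · have := hr.sub (hr.comp (tendsto_atTop_add_const_right atTop (-a) tendsto_id))
      simpa [← sub_eq_add_neg, Function.comp_def] using this
  have hk : ∀ k : ℕ, Tendsto (fun t => z (t - k * a)) (U : Filter ℝ) (𝓝 D) := by
    intro k
    induction k with
    | zero => simpa using hzU
    | succ k ih =>
      rw [Metric.tendsto_nhds] at ih ⊢
      intro ε hε
      -- The lower bound loses at most 3η (from z, from the q-term and from ρ) before division by p,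
      -- and 3η < p ε.
      set η := min (ε / 2) (p * ε / 4) with hη
      have hη0 : 0 < η := by positivity
      have hη1 : η ≤ ε / 2 := min_le_left _ _
      have hη2 : η ≤ p * ε / 4 := min_le_right _ _
      filter_upwards [ih η hη0, (htend ((k + 1 : ℕ) * a)).eventually (hup η hη0),
        (htend (k * a + b)).eventually (hup η hη0),
        (htend (k * a)).eventually (Metric.tendsto_nhds.mp hρ η hη0)] with t h1 h2 h3 h4
      have e := hrz (t - k * a)
      rw [Real.dist_eq, abs_lt] at h1 h4 ⊢
      push_cast at *
      rw [show t - k * a - a = t - (k + 1) * a by ring,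
        show t - k * a - b = t - (k * a + b) by ring] at e
      refine ⟨?_, by linarith⟩
      have h5 : q * z (t - (k * a + b)) ≤ q * (D + η) := by gcongr
      have h6 : q * η ≤ η := by nlinarith
      have h7 : q * D = D - p * D := by linear_combination D * hpq
      have h8 : p * (-ε) < p * (z (t - (k + 1) * a) - D) := by nlinarith
      exact lt_of_mul_lt_mul_left h8 hp.le
  have hsum : ∀ K : ℕ, (K : ℝ) * D ≤ 2 * M := by
    intro K
    have h1 : Tendsto (fun t => ∑ k ∈ Finset.range K, z (t - k * a)) (U : Filter ℝ)
        (𝓝 (∑ k ∈ Finset.range K, D)) := tendsto_finsetSum _ fun k _ => hk k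
    rw [Finset.sum_const, Finset.card_range, nsmul_eq_mul] at h1
    refine le_of_tendsto h1 (Eventually.of_forall fun t => ?_)
    have h2 : ∑ k ∈ Finset.range K, z (t - k * a) = u t - u (t - K * a) := by
      have := Finset.sum_range_sub' (fun k : ℕ => u (t - k * a)) K
      simp only [Nat.cast_zero, zero_mul, sub_zero] at this
      rw [← this]
      refine Finset.sum_congr rfl fun k _ => ?_
      simp only [hz]
      push_cast
      ring_nf
    rw [h2]
    linarith [(abs_le.mp (hM t)).2, (abs_le.mp (hM (t - K * a))).1]
  by_contra hneg
  push Not at hneg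
  obtain ⟨K, hK⟩ := exists_nat_gt (2 * M / D)
  rw [div_lt_iff₀ hneg] at hK
  linarith [hsum K]

/-- The translations under which `u` is asymptotically invariant at `+∞`. -/
def asymptoticPeriods (u : ℝ → ℝ) : AddSubgroup ℝ where
  carrier := {s | Tendsto (fun t => u (t + s) - u t) atTop (𝓝 0)}
  zero_mem' := by simp
  add_mem' := by
    intro s s' hs hs'
    have h := (hs'.comp (tendsto_atTop_add_const_right atTop s tendsto_id)).add hs
    simp only [Function.comp_def, id, add_zero] at h
    refine h.congr fun t => ?_
    rw [← add_assoc]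
    ring
  neg_mem' := by
    intro s hs
    have h := (hs.comp (tendsto_atTop_add_const_right atTop (-s) tendsto_id)).neg
    simp only [Function.comp_def, id, neg_zero] at h
    refine h.congr fun t => ?_
    rw [neg_add_cancel_right]
    ring

theorem mem_asymptoticPeriods {u : ℝ → ℝ} {s : ℝ} :
    s ∈ asymptoticPeriods u ↔ Tendsto (fun t => u (t + s) - u t) atTop (𝓝 0) := Iff.rfl

/-- A bounded asymptotic solution of the renewal equation is asymptotically invariant under the
steps of the random walk. -/
theorem mem_asymptoticPeriods_of_renewal {p q a b M : ℝ} (hp : 0 < p) (hq : 0 ≤ q)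
    (hpq : p + q = 1) {u : ℝ → ℝ} (hM : ∀ t, |u t| ≤ M)
    (hr : Tendsto (fun t => u t - p * u (t - a) - q * u (t - b)) atTop (𝓝 0)) :
    a ∈ asymptoticPeriods u := by
  rw [← neg_mem_iff, mem_asymptoticPeriods, Metric.tendsto_nhds]
  intro ε hε
  have hr' : Tendsto (fun t => (-u) t - p * (-u) (t - a) - q * (-u) (t - b)) atTop (𝓝 0) := by
    have := hr.neg
    rw [neg_zero] at this
    refine this.congr fun t => ?_
    simp only [Pi.neg_apply]
    ring
  filter_upwards [eventually_sub_lt hp hq hpq hM hr hε,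
    eventually_sub_lt hp hq hpq (u := -u) (by simpa using hM) hr' hε] with t h1 h2
  simp only [Pi.neg_apply] at h2
  rw [Real.dist_eq, sub_zero, ← sub_eq_add_neg, abs_lt]
  constructor <;> linarith

/-- Uniform continuity makes u(t + s) - u(t + s') small uniformly in t for s' near s. -/
theorem isClosed_asymptoticPeriods {u : ℝ → ℝ} (hu : UniformContinuous u) :
    IsClosed (asymptoticPeriods u : Set ℝ) := by
  rw [← closure_subset_iff_isClosed]
  intro s hs
  rw [SetLike.mem_coe, mem_asymptoticPeriods, Metric.tendsto_nhds]
  intro ε hε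
  obtain ⟨δ, hδ, h⟩ := Metric.uniformContinuous_iff.mp hu (ε / 2) (by positivity)
  obtain ⟨s', hs', hd⟩ := Metric.mem_closure_iff.mp hs δ hδ
  rw [SetLike.mem_coe, mem_asymptoticPeriods, Metric.tendsto_nhds] at hs'
  filter_upwards [hs' (ε / 2) (by positivity)] with t ht
  have h1 : dist (u (t + s)) (u (t + s')) < ε / 2 := h (by simpa using hd)
  rw [Real.dist_eq] at *
  rw [abs_lt] at *
  constructor <;> linarith [h1.1, h1.2, ht.1, ht.2]

/-- The averages over the past steps that are conserved by the renewal equation, up to the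
inhomogeneous term. -/
noncomputable def renewalAverage (p q a b : ℝ) (u : ℝ → ℝ) (t : ℝ) : ℝ :=
  p * (∫ s in (t - a)..t, u s) + q * ∫ s in (t - b)..t, u s

/-- The derivative is p (u(t) - u(t - a)) + q (u(t) - u(t - b)), which is g(t) since p + q = 1. -/
theorem hasDerivAt_renewalAverage {p q a b : ℝ} (hpq : p + q = 1) {u g : ℝ → ℝ}
    (hu : Continuous u) (h : ∀ t, u t = g t + p * u (t - a) + q * u (t - b)) (t : ℝ) :
    HasDerivAt (renewalAverage p q a b u) (g t) t := by
  have hU : ∀ s, HasDerivAt (fun t => ∫ x in (0 : ℝ)..t, u x) (u s) s := fun s =>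
    intervalIntegral.integral_hasDerivAt_right (hu.intervalIntegrable _ _)
      hu.stronglyMeasurable.stronglyMeasurableAtFilter hu.continuousAt
  have hc : ∀ c, HasDerivAt (fun t => ∫ x in (t - c)..t, u x) (u t - u (t - c)) t := by
    intro c
    have h1 := (hU t).sub ((hU (t - c)).comp_sub_const t c)
    refine h1.congr_of_eventuallyEq (Eventually.of_forall fun s => ?_)
    exact (intervalIntegral.integral_interval_sub_left (hu.intervalIntegrable _ _)
      (hu.intervalIntegrable _ _)).symm
  have h1 := ((hc a).const_mul p).add ((hc b).const_mul q)
  convert! h1 using 1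
  have : u t = (p + q) * u t := by rw [hpq, one_mul]
  linarith [h t]

theorem tendsto_average_sub {u : ℝ → ℝ} {M : ℝ} (hu : Continuous u) (hM : ∀ t, |u t| ≤ M)
    (hper : ∀ s, s ∈ asymptoticPeriods u) {a : ℝ} :
    Tendsto (fun t => (∫ s in (t - a)..t, u s) - a * u t) atTop (𝓝 0) := by
  have h1 : ∀ t, (∫ s in (t - a)..t, u s) - a * u t = ∫ s in (-a)..0, (u (t + s) - u t) := by
    intro t
    rw [intervalIntegral.integral_sub
      ((by fun_prop : Continuous fun s => u (t + s)).intervalIntegrable _ _)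
      (intervalIntegrable_const), intervalIntegral.integral_const,
      intervalIntegral.integral_comp_add_left]
    simp [← sub_eq_add_neg]
  simp only [h1]
  rw [show 𝓝 (0 : ℝ) = 𝓝 (∫ _s in (-a)..0, (0 : ℝ)) by simp]
  refine intervalIntegral.tendsto_integral_filter_of_dominated_convergence (fun _ => 2 * M)
    (Eventually.of_forall fun t => ?_) (Eventually.of_forall fun t => ?_)
    intervalIntegrable_const (Eventually.of_forall fun s _ => hper s)
  · exact (by fun_prop : Continuous fun s => u (t + s) - u t).aestronglyMeasurable
  · refine Eventually.of_forall fun s _ => ?_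
    rw [Real.norm_eq_abs]
    linarith [abs_sub (u (t + s)) (u t), hM t, hM (t + s)]

/-- The renewal theorem for a walk with two steps whose ratio is irrational. -/
theorem tendsto_of_renewalAverage {p q a b M c : ℝ} (hp : 0 < p) (hq : 0 < q) (hpq : p + q = 1)
    (hab : Irrational (a / b)) {u : ℝ → ℝ} (hu : UniformContinuous u) (hM : ∀ t, |u t| ≤ M)
    (hr : Tendsto (fun t => u t - p * u (t - a) - q * u (t - b)) atTop (𝓝 0))
    (hV : Tendsto (renewalAverage p q a b u) atTop (𝓝 c)) :
    Tendsto (fun t => (p * a + q * b) * u t) atTop (𝓝 c) := by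
  have ha := mem_asymptoticPeriods_of_renewal hp hq.le hpq hM hr
  have hb := mem_asymptoticPeriods_of_renewal (a := b) (b := a) hq hp.le (by linarith) hM
    (hr.congr fun t => by ring)
  -- An irrational ratio makes the group generated by a and b dense, and the group of asymptotic
  -- periods is closed.
  have hper : ∀ s, s ∈ asymptoticPeriods u := by
    have h1 := dense_addSubgroupClosure_pair_iff.mpr hab
    have h2 : AddSubgroup.closure {a, b} ≤ asymptoticPeriods u := by
      rw [AddSubgroup.closure_le]
      rintro x (rfl | rfl)
      exacts [ha, hb]
    have h3 := (h1.mono (SetLike.coe_subset_coe.mpr h2)).closure_eq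
    rw [(isClosed_asymptoticPeriods hu).closure_eq] at h3
    exact fun s => by rw [← SetLike.mem_coe, h3]; trivial
  have h1 := ((tendsto_average_sub (a := a) hu.continuous hM hper).const_mul p).add
    ((tendsto_average_sub (a := b) hu.continuous hM hper).const_mul q)
  have h2 := hV.sub h1
  simp only [mul_zero, add_zero, sub_zero] at h2
  refine h2.congr fun t => ?_
  rw [renewalAverage]
  ring

/-- The analogue of `renewalAverage` for a walk on the lattice `d ℤ`. -/
noncomputable def latticeAverage (p q d : ℝ) (A B : ℕ) (u : ℝ → ℝ) (t : ℝ) : ℝ :=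
  p * (∑ j ∈ Finset.range A, u (t - j * d)) + q * ∑ j ∈ Finset.range B, u (t - j * d)

theorem latticeAverage_sub {p q d : ℝ} {A B : ℕ} (hpq : p + q = 1) {u g : ℝ → ℝ}
    (h : ∀ t, u t = g t + p * u (t - A * d) + q * u (t - B * d)) (t : ℝ) :
    latticeAverage p q d A B u t - latticeAverage p q d A B u (t - d) = g t := by
  have key : ∀ K : ℕ, ∑ j ∈ Finset.range K, u (t - j * d) -
      ∑ j ∈ Finset.range K, u (t - d - j * d) = u t - u (t - K * d) := by
    intro K
    rw [← Finset.sum_sub_distrib]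
    have := Finset.sum_range_sub' (fun k : ℕ => u (t - k * d)) K
    simp only [Nat.cast_zero, zero_mul, sub_zero] at this
    rw [← this]
    refine Finset.sum_congr rfl fun k _ => ?_
    push_cast
    ring_nf
  rw [latticeAverage, latticeAverage]
  linear_combination p * key A + q * key B + u t * hpq + h t

theorem tendsto_latticeAverage_sub {p q d : ℝ} {A B : ℕ} {u : ℝ → ℝ}
    (hd : d ∈ asymptoticPeriods u) :
    Tendsto (fun t => latticeAverage p q d A B u t - (p * A + q * B) * u t) atTop (𝓝 0) := by
  have key : ∀ K : ℕ, Tendsto (fun t => ∑ j ∈ Finset.range K, (u (t - j * d) - u t)) atTop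
      (𝓝 0) := by
    intro K
    rw [← Finset.sum_const_zero (ι := ℕ) (s := Finset.range K)]
    refine tendsto_finsetSum _ fun j _ => ?_
    have := (asymptoticPeriods u).neg_mem ((asymptoticPeriods u).nsmul_mem hd j)
    rw [mem_asymptoticPeriods] at this
    simpa [sub_eq_add_neg] using this
  have h := ((key A).const_mul p).add ((key B).const_mul q)
  simp only [mul_zero, add_zero] at h
  refine h.congr fun t => ?_
  simp only [latticeAverage, Finset.sum_sub_distrib, Finset.sum_const, Finset.card_range,
    nsmul_eq_mul]
  ring

/-- By `latticeAverage_sub` the partial sums telescope, and the average vanishes at -∞. -/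
theorem hasSum_latticeAverage {p q d : ℝ} {A B : ℕ} (hpq : p + q = 1) (hd : 0 < d)
    {u g : ℝ → ℝ} (hg : ∀ t, 0 ≤ g t) (hu : Tendsto u atBot (𝓝 0))
    (h : ∀ t, u t = g t + p * u (t - A * d) + q * u (t - B * d)) (t : ℝ) :
    HasSum (fun k : ℕ => g (t - k * d)) (latticeAverage p q d A B u t) := by
  rw [hasSum_iff_tendsto_nat_of_nonneg fun k => hg _]
  have h1 : ∀ n : ℕ, ∑ k ∈ Finset.range n, g (t - k * d) =
      latticeAverage p q d A B u t - latticeAverage p q d A B u (t - n * d) := by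
    intro n
    have := Finset.sum_range_sub' (fun k : ℕ => latticeAverage p q d A B u (t - k * d)) n
    simp only [Nat.cast_zero, zero_mul, sub_zero] at this
    rw [← this]
    refine Finset.sum_congr rfl fun k _ => ?_
    rw [← latticeAverage_sub hpq h]
    push_cast
    ring_nf
  have h2 : Tendsto (latticeAverage p q d A B u) atBot (𝓝 0) := by
    have key : ∀ K : ℕ, Tendsto (fun t => ∑ j ∈ Finset.range K, u (t - j * d)) atBot (𝓝 0) := by
      intro K
      rw [← Finset.sum_const_zero (ι := ℕ) (s := Finset.range K)]
      refine tendsto_finsetSum _ fun j _ => ?_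
      exact hu.comp (tendsto_atBot_add_const_right _ (-(j * d)) tendsto_id)
    have := ((key A).const_mul p).add ((key B).const_mul q)
    simp only [mul_zero, add_zero] at this
    exact this
  have h3 : Tendsto (fun n : ℕ => t - n * d) atTop atBot := by
    have := (tendsto_natCast_atTop_atTop (R := ℝ)).atTop_mul_const hd
    exact tendsto_atBot_add_const_left _ t (tendsto_neg_atTop_atBot.comp this)
  simp only [h1]
  simpa using (h2.comp h3).const_sub (latticeAverage p q d A B u t)

/-- The renewal theorem for a walk with two steps in a lattice. -/
theorem tendsto_sub_tsum_of_lattice {p q d M : ℝ} {A B : ℕ} (hp : 0 < p) (hq : 0 < q)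
    (hpq : p + q = 1) (hd : 0 < d) (hAB : IsCoprime (A : ℤ) (B : ℤ)) {u g : ℝ → ℝ}
    (hM : ∀ t, |u t| ≤ M) (hg : ∀ t, 0 ≤ g t) (hg' : ∀ t, g t ≤ Real.exp (-t))
    (hu : Tendsto u atBot (𝓝 0))
    (h : ∀ t, u t = g t + p * u (t - A * d) + q * u (t - B * d)) :
    Tendsto (fun t => (p * A + q * B) * u t - ∑' k : ℤ, g (t - k * d)) atTop (𝓝 0) := by
  have hg0 : Tendsto g atTop (𝓝 0) :=
    squeeze_zero hg hg' (Real.tendsto_exp_neg_atTop_nhds_zero)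
  have hr : Tendsto (fun t => u t - p * u (t - A * d) - q * u (t - B * d)) atTop (𝓝 0) :=
    hg0.congr fun t => by rw [h t]; ring
  have hA := mem_asymptoticPeriods_of_renewal hp hq.le hpq hM hr
  have hB := mem_asymptoticPeriods_of_renewal (a := B * d) (b := A * d) hq hp.le (by linarith) hM
    (hr.congr fun t => by ring)
  -- Bézout: d is an integer combination of A d and B d.
  have hdm : d ∈ asymptoticPeriods u := by
    obtain ⟨x, y, hxy⟩ := hAB
    have h1 := add_mem (zsmul_mem hA x) (zsmul_mem hB y)
    have h2 : (x : ℝ) * A + y * B = 1 := by exact_mod_cast hxy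
    convert! h1 using 1
    simp only [zsmul_eq_mul]
    linear_combination -d * h2
  have hgeo : Summable fun n : ℕ => Real.exp (-((n + 1 : ℝ) * d)) := by
    have := (summable_nat_add_iff 1).mpr
      (summable_geometric_of_lt_one (Real.exp_pos (-d)).le (by simpa using hd))
    refine this.congr fun n => ?_
    rw [← Real.exp_nat_mul]
    push_cast
    ring_nf
  have hle : ∀ t, ∀ n : ℕ, g (t - (-((n : ℤ) + 1) : ℤ) * d) ≤
      Real.exp (-t) * Real.exp (-((n + 1 : ℝ) * d)) := by
    intro t n
    rw [← Real.exp_add]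
    refine (hg' _).trans_eq ?_
    push_cast
    ring_nf
  have hsum : ∀ t, Summable fun n : ℕ => g (t - (-((n : ℤ) + 1) : ℤ) * d) := fun t =>
    Summable.of_nonneg_of_le (fun n => hg _) (hle t) (hgeo.mul_left _)
  -- The terms k ≥ 0 sum exactly to the conserved average; those with k = -(n + 1) are at most
  -- e^{-t} times a geometric series and vanish as t → ∞.
  have htsum : ∀ t, ∑' k : ℤ, g (t - k * d) = latticeAverage p q d A B u t +
      ∑' n : ℕ, g (t - (-((n : ℤ) + 1) : ℤ) * d) := fun t =>
    (HasSum.of_nat_of_neg_add_one (f := fun k : ℤ => g (t - k * d))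
      (by simpa using hasSum_latticeAverage hpq hd hg hu h t) (hsum t).hasSum).tsum_eq
  have htail : Tendsto (fun t => ∑' n : ℕ, g (t - (-((n : ℤ) + 1) : ℤ) * d)) atTop (𝓝 0) := by
    refine squeeze_zero (fun t => tsum_nonneg fun n => hg _)
      (fun t => (hsum t).tsum_le_tsum (hle t) (hgeo.mul_left _)) ?_
    simp only [tsum_mul_left]
    simpa using Real.tendsto_exp_neg_atTop_nhds_zero.mul_const
      (∑' n : ℕ, Real.exp (-((n + 1 : ℝ) * d)))
  have := ((tendsto_latticeAverage_sub (p := p) (q := q) (A := A) (B := B) hdm).add htail).neg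
  simp only [add_zero, neg_zero] at this
  refine this.congr fun t => ?_
  rw [htsum]
  ring

end Renewal

/-! ### The Poisson tail, the root term and its integral -/

theorem poissonTail_nonneg (x : ℝ) : 0 ≤ poissonTail x := by
  have h := mul_le_mul_of_nonneg_right (Real.add_one_le_exp x) (Real.exp_pos (-x)).le
  rw [← Real.exp_add, add_neg_cancel, Real.exp_zero] at h
  rw [poissonTail]
  linarith

theorem poissonTail_le_one {x : ℝ} (hx : 0 ≤ x) : poissonTail x ≤ 1 := by
  have : 0 ≤ (1 + x) * Real.exp (-x) := by positivity
  rw [poissonTail]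
  linarith

theorem poissonTail_le_sq {x : ℝ} (hx : 0 ≤ x) : poissonTail x ≤ x ^ 2 := by
  have h := mul_le_mul_of_nonneg_left (Real.add_one_le_exp (-x)) (by linarith : 0 ≤ 1 + x)
  rw [poissonTail]
  linarith

theorem hasDerivAt_poissonTail (x : ℝ) : HasDerivAt poissonTail (x * Real.exp (-x)) x := by
  have h1 : HasDerivAt (fun x : ℝ => 1 - (1 + x) * Real.exp (-x))
      (-(1 * Real.exp (-x) + (1 + x) * (Real.exp (-x) * -1))) x :=
    (((hasDerivAt_id x).const_add 1).mul (hasDerivAt_neg x).exp).const_sub 1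
  convert! h1 using 1
  ring

theorem continuous_poissonTail : Continuous poissonTail :=
  continuous_iff_continuousAt.mpr fun x => (hasDerivAt_poissonTail x).continuousAt

theorem monotoneOn_poissonTail : MonotoneOn poissonTail (Set.Ici 0) := by
  refine monotoneOn_of_deriv_nonneg (convex_Ici 0) continuous_poissonTail.continuousOn
    (fun x _ => (hasDerivAt_poissonTail x).differentiableAt.differentiableWithinAt) fun x hx => ?_
  rw [(hasDerivAt_poissonTail x).deriv]
  rw [interior_Ici] at hx
  exact mul_nonneg hx.le (Real.exp_pos _).le

/-- The sign of the derivative reduces to 1 + x + x²/2 ≤ e^x. -/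
theorem antitoneOn_poissonTail_div_sq : AntitoneOn (fun x => poissonTail x / x ^ 2) (Set.Ioi 0) := by
  have hd : ∀ x ∈ Set.Ioi (0 : ℝ), HasDerivAt (fun x => poissonTail x / x ^ 2)
      ((x * Real.exp (-x) * x ^ 2 - poissonTail x * (2 * x)) / (x ^ 2) ^ 2) x := by
    intro x hx
    have h2 : HasDerivAt (fun x : ℝ => x ^ 2) (2 * x) x := by simpa using hasDerivAt_pow 2 x
    exact (hasDerivAt_poissonTail x).div h2 (pow_ne_zero 2 (ne_of_gt hx))
  refine antitoneOn_of_deriv_nonpos (convex_Ioi 0)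
    (fun x hx => (hd x hx).continuousAt.continuousWithinAt)
    (fun x hx => (hd x (interior_subset hx)).differentiableAt.differentiableWithinAt) ?_
  intro x hx
  rw [interior_Ioi] at hx
  rw [(hd x hx).deriv]
  have hx0 : 0 < x := hx
  refine div_nonpos_of_nonpos_of_nonneg ?_ (by positivity)
  have h1 := mul_le_mul_of_nonneg_right (Real.quadratic_le_exp_of_nonneg hx0.le)
    (Real.exp_pos (-x)).le
  rw [← Real.exp_add x, add_neg_cancel, Real.exp_zero] at h1
  rw [poissonTail]
  nlinarith

theorem poissonTail_mul_le {c x : ℝ} (hc : 1 ≤ c) (hx : 0 < x) :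
    poissonTail (c * x) ≤ c ^ 2 * poissonTail x := by
  have hcx : 0 < c * x := by positivity
  have h := antitoneOn_poissonTail_div_sq (Set.mem_Ioi.mpr hx) (Set.mem_Ioi.mpr hcx)
    (le_mul_of_one_le_left hx.le hc)
  dsimp only at h
  rw [div_le_div_iff₀ (by positivity) (by positivity)] at h
  have hx2 : 0 < x ^ 2 := by positivity
  nlinarith

/-- The contribution of the root to the normalized expected size of the trie. -/
noncomputable def rootTerm (t : ℝ) : ℝ := Real.exp (-t) * poissonTail (Real.exp t)

/-- The expected number of internal nodes in the Poisson model, divided by the mean number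
`exp t` of strings. -/
noncomputable def meanSize (p t : ℝ) : ℝ :=
  Real.exp (-t) * ∑' α, poissonTail (Real.exp t * wordProb p α)

theorem rootTerm_nonneg (t : ℝ) : 0 ≤ rootTerm t :=
  mul_nonneg (Real.exp_pos _).le (poissonTail_nonneg _)

theorem rootTerm_le_exp_neg (t : ℝ) : rootTerm t ≤ Real.exp (-t) :=
  mul_le_of_le_one_right (Real.exp_pos _).le (poissonTail_le_one (Real.exp_pos _).le)

theorem rootTerm_le_exp (t : ℝ) : rootTerm t ≤ Real.exp t := by
  have h := mul_le_mul_of_nonneg_left (poissonTail_le_sq (Real.exp_pos t).le) (Real.exp_pos (-t)).le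
  rwa [sq, ← mul_assoc, ← Real.exp_add, neg_add_cancel, Real.exp_zero, one_mul] at h

theorem continuous_rootTerm : Continuous rootTerm :=
  (Real.continuous_exp.comp continuous_neg).mul (continuous_poissonTail.comp Real.continuous_exp)

/-- The antiderivative of `rootTerm` that vanishes at `-∞`. -/
noncomputable def rootIntegral (t : ℝ) : ℝ := 1 - (1 - Real.exp (-Real.exp t)) * Real.exp (-t)

theorem hasDerivAt_rootIntegral (t : ℝ) : HasDerivAt rootIntegral (rootTerm t) t := by
  have h1 : HasDerivAt (fun t : ℝ => 1 - (1 - Real.exp (-Real.exp t)) * Real.exp (-t))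
      (-(-(Real.exp (-Real.exp t) * -Real.exp t) * Real.exp (-t) +
        (1 - Real.exp (-Real.exp t)) * (Real.exp (-t) * -1))) t :=
    ((((Real.hasDerivAt_exp t).neg.exp).const_sub 1).mul (hasDerivAt_neg t).exp).const_sub 1
  convert! h1 using 1
  rw [rootTerm, poissonTail]
  ring

theorem rootIntegral_nonneg (t : ℝ) : 0 ≤ rootIntegral t := by
  have h := mul_le_mul_of_nonneg_right (Real.add_one_le_exp (-Real.exp t)) (Real.exp_pos (-t)).le
  have h2 : Real.exp t * Real.exp (-t) = 1 := by rw [← Real.exp_add, add_neg_cancel, Real.exp_zero]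
  rw [rootIntegral]
  nlinarith

theorem rootIntegral_le_one (t : ℝ) : rootIntegral t ≤ 1 := by
  have h : Real.exp (-Real.exp t) ≤ 1 := Real.exp_le_one_iff.mpr (by linarith [Real.exp_pos t])
  have := mul_nonneg (sub_nonneg.mpr h) (Real.exp_pos (-t)).le
  rw [rootIntegral]
  linarith

theorem rootIntegral_le_exp (t : ℝ) : rootIntegral t ≤ Real.exp t := by
  have h2 : Real.exp t * Real.exp (-t) = 1 := by rw [← Real.exp_add, add_neg_cancel, Real.exp_zero]
  -- The left side is `rootIntegral t` rearranged. With y = e^t the claim amounts to e^{-y} ≤ 1 - y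
  -- + y², a consequence of (1 + y) e^{-y} ≤ 1.
  have h1 : (1 - Real.exp (-t)) * (1 - Real.exp (-Real.exp t)) +
      Real.exp (-Real.exp t) ≤ Real.exp t := by
    have h3 := poissonTail_nonneg (Real.exp t)
    have h4 := Real.exp_pos t
    have h5 : Real.exp (-Real.exp t) ≤ 1 := Real.exp_le_one_iff.mpr (by linarith)
    rw [poissonTail] at h3
    set y := Real.exp t
    set E := Real.exp (-y)
    have h6 : Real.exp (-t) = y⁻¹ := Real.exp_neg t
    rw [h6]
    have h7 : y * ((1 - y⁻¹) * (1 - E) + E) ≤ y * y := by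
      have : y * ((1 - y⁻¹) * (1 - E) + E) = (y - 1) * (1 - E) + y * E := by
        field_simp
      rw [this]
      nlinarith [Real.add_one_le_exp (-y)]
    exact le_of_mul_le_mul_left h7 h4
  rw [rootIntegral]
  linarith

theorem tendsto_rootIntegral_atTop : Tendsto rootIntegral atTop (𝓝 1) := by
  have h1 : Tendsto (fun t : ℝ => 1 - Real.exp (-t)) atTop (𝓝 1) := by
    simpa using Real.tendsto_exp_neg_atTop_nhds_zero.const_sub 1
  refine tendsto_of_tendsto_of_tendsto_of_le_of_le h1 tendsto_const_nhds (fun t => ?_)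
    rootIntegral_le_one
  rw [rootIntegral]
  nlinarith [Real.exp_pos (-Real.exp t), Real.exp_pos (-t)]

theorem tendsto_rootIntegral_atBot : Tendsto rootIntegral atBot (𝓝 0) :=
  squeeze_zero rootIntegral_nonneg rootIntegral_le_exp Real.tendsto_exp_atBot

theorem meanSize_nonneg (p t : ℝ) : 0 ≤ meanSize p t :=
  mul_nonneg (Real.exp_pos _).le (tsum_nonneg fun _ => poissonTail_nonneg _)

theorem entropy_eq (p : ℝ) : p * -Real.log p + (1 - p) * -Real.log (1 - p) = Real.binEntropy p := by
  simp [Real.binEntropy]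

/-! ### The normalized Poisson mean and its asymptotics -/

section MeanSize

variable {p : ℝ} (hp0 : 0 < p) (hp1 : p < 1)
include hp0 hp1

theorem summable_poissonTail {l : ℝ} (hl : 0 ≤ l) :
    Summable fun α => poissonTail (l * wordProb p α) := by
  refine Summable.of_nonneg_of_le (fun α => poissonTail_nonneg _) (fun α => ?_)
    ((summable_wordProb_sq hp0 hp1).mul_left (l ^ 2))
  rw [← mul_pow]
  exact poissonTail_le_sq (mul_nonneg hl (wordProb_pos hp0 hp1 α).le)

/-- The empty word gives the root term. Words beginning with a letter of probability r see the mean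
r e^t, which is a shift of t by -ln r. -/
theorem meanSize_eq (t : ℝ) : meanSize p t =
    rootTerm t + p * meanSize p (t - -Real.log p) +
      (1 - p) * meanSize p (t - -Real.log (1 - p)) := by
  have hstep : ∀ r : ℝ, 0 < r → r * meanSize p (t - -Real.log r) =
      Real.exp (-t) * ∑' α, poissonTail (Real.exp t * (r * wordProb p α)) := by
    intro r hr
    have h1 : Real.exp (t - -Real.log r) = Real.exp t * r := by
      rw [sub_neg_eq_add, Real.exp_add, Real.exp_log hr]
    have h2 : r * Real.exp (-(t - -Real.log r)) = Real.exp (-t) := by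
      rw [Real.exp_neg, h1, Real.exp_neg]
      field_simp
    rw [meanSize, ← mul_assoc, h2, h1]
    simp only [mul_assoc]
  have hs : ∀ b, Summable fun α => poissonTail (Real.exp t * wordProb p (b :: α)) := fun b =>
    (summable_poissonTail hp0 hp1 (Real.exp_pos t).le).comp_injective
      (i := fun α => b :: α) List.cons_injective
  have hw := tsum_word (fun α => poissonTail (Real.exp t * wordProb p α)) (hs false) (hs true)
  have h0 : wordProb p [] = 1 := rfl
  have h1 : ∀ α, wordProb p (true :: α) = p * wordProb p α := fun α => rfl
  have h2 : ∀ α, wordProb p (false :: α) = (1 - p) * wordProb p α := fun α => rfl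
  simp only [h0, h1, h2, mul_one] at hw
  rw [hstep p hp0, hstep (1 - p) (by linarith), meanSize, hw, rootTerm]
  ring

theorem meanSize_le_exp (t : ℝ) :
    meanSize p t ≤ (∑' α, wordProb p α ^ 2) * Real.exp t := by
  have h1 : ∑' α, poissonTail (Real.exp t * wordProb p α) ≤
      ∑' α, Real.exp t ^ 2 * wordProb p α ^ 2 := by
    refine (summable_poissonTail hp0 hp1 (Real.exp_pos t).le).tsum_le_tsum (fun α => ?_)
      ((summable_wordProb_sq hp0 hp1).mul_left _)
    rw [← mul_pow]
    exact poissonTail_le_sq (mul_nonneg (Real.exp_pos t).le (wordProb_pos hp0 hp1 α).le)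
  rw [tsum_mul_left] at h1
  refine (mul_le_mul_of_nonneg_left h1 (Real.exp_pos (-t)).le).trans_eq ?_
  rw [Real.exp_neg]
  field_simp

theorem tendsto_meanSize_atBot : Tendsto (meanSize p) atBot (𝓝 0) := by
  refine squeeze_zero (meanSize_nonneg p) (meanSize_le_exp hp0 hp1) ?_
  simpa using Real.tendsto_exp_atBot.const_mul (∑' α, wordProb p α ^ 2)

/-- The Poisson tail f increases while f(x)/x² decreases. This regularity supplies the continuity,
the boundedness and the uniform continuity of `meanSize`. -/
theorem meanSize_add_bounds {s : ℝ} (hs : 0 ≤ s) (t : ℝ) :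
    Real.exp (-s) * meanSize p t ≤ meanSize p (t + s) ∧
      meanSize p (t + s) ≤ Real.exp s * meanSize p t := by
  have hw := wordProb_pos hp0 hp1
  have hE : 1 ≤ Real.exp s := Real.one_le_exp hs
  have hsum := fun t : ℝ => summable_poissonTail hp0 hp1 (Real.exp_pos t).le
  constructor
  · have h1 : ∑' α, poissonTail (Real.exp t * wordProb p α) ≤
        ∑' α, poissonTail (Real.exp (t + s) * wordProb p α) := by
      refine (hsum t).tsum_le_tsum (fun α => ?_) (hsum (t + s))
      refine monotoneOn_poissonTail (Set.mem_Ici.mpr ?_) (Set.mem_Ici.mpr ?_) ?_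
      · exact mul_nonneg (Real.exp_pos _).le (hw α).le
      · exact mul_nonneg (Real.exp_pos _).le (hw α).le
      · exact mul_le_mul_of_nonneg_right (Real.exp_le_exp.mpr (by linarith)) (hw α).le
    rw [meanSize, meanSize, ← mul_assoc, ← Real.exp_add, ← neg_add_rev]
    exact mul_le_mul_of_nonneg_left h1 (Real.exp_pos _).le
  · have h1 : ∑' α, poissonTail (Real.exp (t + s) * wordProb p α) ≤
        ∑' α, Real.exp s ^ 2 * poissonTail (Real.exp t * wordProb p α) := by
      refine (hsum (t + s)).tsum_le_tsum (fun α => ?_) ((hsum t).mul_left _)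
      rw [add_comm, Real.exp_add, mul_assoc]
      exact poissonTail_mul_le hE (mul_pos (Real.exp_pos t) (hw α))
    rw [tsum_mul_left] at h1
    refine (mul_le_mul_of_nonneg_left h1 (Real.exp_pos (-(t + s))).le).trans_eq ?_
    rw [meanSize, neg_add, Real.exp_add, Real.exp_neg s]
    field_simp

theorem abs_meanSize_sub_le (t s : ℝ) :
    |meanSize p s - meanSize p t| ≤ (Real.exp |s - t| - 1) * meanSize p t := by
  have hu := meanSize_nonneg p t
  have key : ∀ r : ℝ, Real.exp r * meanSize p t - meanSize p t ≥ 0 →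
      Real.exp (-r) * meanSize p t ≤ meanSize p s → meanSize p s ≤ Real.exp r * meanSize p t →
      |meanSize p s - meanSize p t| ≤ (Real.exp r - 1) * meanSize p t := by
    intro r h0 h1 h2
    -- This makes 1 - e^{-r} ≤ e^r - 1, so the upper bound's constant also serves below.
    have h3 : 2 ≤ Real.exp r + Real.exp (-r) := by
      have := Real.cosh_eq r
      linarith [Real.one_le_cosh r]
    rw [abs_le]
    constructor <;> nlinarith
  have h0 : 1 ≤ Real.exp |s - t| := Real.one_le_exp (abs_nonneg _)
  refine key _ (by nlinarith) ?_ ?_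
  · rcases le_total t s with h | h
    · have := (meanSize_add_bounds hp0 hp1 (sub_nonneg.mpr h) t).1
      rwa [add_sub_cancel, ← abs_of_nonneg (sub_nonneg.mpr h)] at this
    · have := (meanSize_add_bounds hp0 hp1 (sub_nonneg.mpr h) s).2
      rw [add_sub_cancel, ← abs_of_nonneg (sub_nonneg.mpr h), abs_sub_comm] at this
      rw [Real.exp_neg, inv_mul_le_iff₀ (Real.exp_pos _)]
      exact this
  · rcases le_total t s with h | h
    · have := (meanSize_add_bounds hp0 hp1 (sub_nonneg.mpr h) t).2
      rwa [add_sub_cancel, ← abs_of_nonneg (sub_nonneg.mpr h)] at this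
    · have := (meanSize_add_bounds hp0 hp1 (sub_nonneg.mpr h) s).1
      rw [add_sub_cancel, ← abs_of_nonneg (sub_nonneg.mpr h), abs_sub_comm, Real.exp_neg,
        inv_mul_le_iff₀ (Real.exp_pos _)] at this
      exact this

theorem continuous_meanSize : Continuous (meanSize p) := by
  refine continuous_iff_continuousAt.mpr fun t => ?_
  rw [ContinuousAt, tendsto_iff_dist_tendsto_zero]
  refine squeeze_zero (fun s => dist_nonneg) (fun s => abs_meanSize_sub_le hp0 hp1 t s) ?_
  have : Continuous fun s => (Real.exp |s - t| - 1) * meanSize p t := by fun_prop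
  simpa using this.tendsto t

/-- Both sides have derivative `rootTerm` and vanish at -∞. -/
theorem renewalAverage_meanSize (t : ℝ) :
    renewalAverage p (1 - p) (-Real.log p) (-Real.log (1 - p)) (meanSize p) t =
      rootIntegral t := by
  set V := renewalAverage p (1 - p) (-Real.log p) (-Real.log (1 - p)) (meanSize p) with hV
  have hu := continuous_meanSize hp0 hp1
  have hd : ∀ t, HasDerivAt (fun t => V t - rootIntegral t) 0 t := fun t => by
    have := (hasDerivAt_renewalAverage (add_sub_cancel p 1) hu (meanSize_eq hp0 hp1) t).sub
      (hasDerivAt_rootIntegral t)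
    rw [sub_self] at this
    exact this
  have hconst : ∀ s, V s - rootIntegral s = V t - rootIntegral t := fun s =>
    is_const_of_deriv_eq_zero (fun t => (hd t).differentiableAt) (fun t => (hd t).deriv) s t
  have hint : ∀ a : ℝ, 0 ≤ a → Tendsto (fun t => ∫ s in (t - a)..t, meanSize p s) atBot (𝓝 0) := by
    intro a ha
    set C := ∑' α, wordProb p α ^ 2
    have hC : 0 ≤ C := tsum_nonneg fun α => sq_nonneg _
    refine squeeze_zero_norm (a := fun t => C * Real.exp t * a) (fun t => ?_) ?_
    · have := intervalIntegral.norm_integral_le_of_norm_le_const (a := t - a) (b := t)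
        (f := meanSize p) (C := C * Real.exp t) fun s hs => ?_
      · rwa [sub_sub_cancel, abs_of_nonneg ha] at this
      · rw [Set.uIoc_of_le (by linarith)] at hs
        rw [Real.norm_of_nonneg (meanSize_nonneg p s)]
        refine (meanSize_le_exp hp0 hp1 s).trans ?_
        exact mul_le_mul_of_nonneg_left (Real.exp_le_exp.mpr hs.2) hC
    · simpa using (Real.tendsto_exp_atBot.const_mul C).mul_const a
  have hlim : Tendsto (fun t => V t - rootIntegral t) atBot (𝓝 0) := by
    have h1 := ((hint (-Real.log p) (by linarith [Real.log_neg hp0 hp1])).const_mul p).add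
      ((hint (-Real.log (1 - p))
        (by linarith [Real.log_neg (x := 1 - p) (by linarith) (by linarith)])).const_mul (1 - p))
    simp only [mul_zero, add_zero] at h1
    simpa using Tendsto.sub (f := V) h1 tendsto_rootIntegral_atBot
  have := tendsto_nhds_unique (hlim.congr hconst) tendsto_const_nhds
  linarith

/-- The conserved average is at most 1, and `meanSize` drops at most by the factor e^{-a} on [t, t +
a]; hence p a e^{-a} u(t) ≤ 1. -/
theorem exists_meanSize_le : ∃ M, ∀ t, |meanSize p t| ≤ M := by
  set a := -Real.log p with ha
  have ha0 : 0 < a := by linarith [Real.log_neg hp0 hp1]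
  have hb0 : 0 < -Real.log (1 - p) := by
    linarith [Real.log_neg (x := 1 - p) (by linarith) (by linarith)]
  have hu := continuous_meanSize hp0 hp1
  refine ⟨1 / (p * (a * Real.exp (-a))), fun t => ?_⟩
  rw [abs_of_nonneg (meanSize_nonneg p t), le_div_iff₀ (by positivity)]
  have h1 := (renewalAverage_meanSize hp0 hp1 (t + a)).trans_le (rootIntegral_le_one _)
  rw [renewalAverage, ← ha, add_sub_cancel_right] at h1
  have h2 : 0 ≤ ∫ s in (t + a - -Real.log (1 - p))..(t + a), meanSize p s :=
    intervalIntegral.integral_nonneg (by linarith) fun s _ => meanSize_nonneg p s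
  have h3 : ∫ _s in t..(t + a), Real.exp (-a) * meanSize p t ≤ ∫ s in t..(t + a), meanSize p s := by
    refine intervalIntegral.integral_mono_on (by linarith) intervalIntegrable_const
      (hu.intervalIntegrable _ _) fun s hs => ?_
    have h4 := (meanSize_add_bounds hp0 hp1 (sub_nonneg.mpr hs.1) t).1
    rw [add_sub_cancel] at h4
    refine le_trans ?_ h4
    exact mul_le_mul_of_nonneg_right (Real.exp_le_exp.mpr (by linarith [hs.2]))
      (meanSize_nonneg p t)
  rw [intervalIntegral.integral_const, add_sub_cancel_left, smul_eq_mul] at h3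
  have h5 : 0 ≤ (1 - p) * ∫ s in (t + a - -Real.log (1 - p))..(t + a), meanSize p s :=
    mul_nonneg (by linarith) h2
  nlinarith

theorem uniformContinuous_meanSize : UniformContinuous (meanSize p) := by
  obtain ⟨M, hM⟩ := exists_meanSize_le hp0 hp1
  rw [Metric.uniformContinuous_iff]
  intro ε hε
  have hc : Continuous fun r : ℝ => (Real.exp |r| - 1) * M := by fun_prop
  obtain ⟨δ, hδ, h⟩ := Metric.continuousAt_iff.mp (hc.continuousAt (x := 0)) ε hε
  refine ⟨δ, hδ, fun {s t} hst => ?_⟩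
  have h1 := h (x := s - t) (by simpa [Real.dist_eq] using hst)
  refine (abs_meanSize_sub_le hp0 hp1 t s).trans_lt (lt_of_le_of_lt ?_ h1)
  rw [Real.dist_eq]
  refine le_trans ?_ (le_abs_self _)
  simp only [abs_zero, Real.exp_zero, sub_self, zero_mul, sub_zero]
  exact mul_le_mul_of_nonneg_left ((le_abs_self _).trans (hM t))
    (sub_nonneg.mpr (Real.one_le_exp (abs_nonneg _)))

/-- The conserved average tends to 1, and the mean step of the walk is the entropy. -/
theorem tendsto_meanSize_of_irrational (h : Irrational (Real.log p / Real.log (1 - p))) :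
    Tendsto (meanSize p) atTop (𝓝 (1 / Real.binEntropy p)) := by
  obtain ⟨M, hM⟩ := exists_meanSize_le hp0 hp1
  have hr : Tendsto (fun t => meanSize p t - p * meanSize p (t - -Real.log p) -
      (1 - p) * meanSize p (t - -Real.log (1 - p))) atTop (𝓝 0) := by
    refine (squeeze_zero rootTerm_nonneg rootTerm_le_exp_neg
      Real.tendsto_exp_neg_atTop_nhds_zero).congr fun t => ?_
    rw [meanSize_eq hp0 hp1 t]
    ring
  have h1 := tendsto_of_renewalAverage hp0 (by linarith) (by ring) (by rwa [neg_div_neg_eq])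
    (uniformContinuous_meanSize hp0 hp1) hM hr (tendsto_rootIntegral_atTop.congr fun t =>
      (renewalAverage_meanSize hp0 hp1 t).symm)
  rw [entropy_eq] at h1
  refine (h1.div_const (Real.binEntropy p)).congr fun t => ?_
  rw [mul_div_cancel_left₀ _ (Real.binEntropy_pos hp0 hp1).ne']

theorem tendsto_meanSize_sub_of_lattice {d : ℝ} (hd : 0 < d) {A B : ℕ}
    (hA : -Real.log p = A * d) (hB : -Real.log (1 - p) = B * d)
    (hAB : IsCoprime (A : ℤ) (B : ℤ)) :
    Tendsto (fun t => meanSize p t - 1 / Real.binEntropy p * (d * ∑' k : ℤ, rootTerm (t - k * d)))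
      atTop (𝓝 0) := by
  obtain ⟨M, hM⟩ := exists_meanSize_le hp0 hp1
  have h1 := tendsto_sub_tsum_of_lattice (q := 1 - p) hp0 (by linarith) (by ring) hd hAB hM rootTerm_nonneg
    rootTerm_le_exp_neg (tendsto_meanSize_atBot hp0 hp1) (by
      simpa only [hA, hB] using meanSize_eq hp0 hp1)
  have h2 := h1.const_mul (d / Real.binEntropy p)
  rw [mul_zero] at h2
  refine h2.congr fun t => ?_
  have h3 : (p * A + (1 - p) * B) * d = Real.binEntropy p := by
    rw [← entropy_eq, hA, hB]
    ring
  have h4 := (Real.binEntropy_pos hp0 hp1).ne'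
  rw [mul_sub, ← mul_assoc, show d / Real.binEntropy p * (p * A + (1 - p) * B) = 1 by
    rw [div_mul_eq_mul_div, mul_comm d, h3, div_self h4]]
  ring

end MeanSize

/-! ### From the Poisson model to a fixed number of strings -/

theorem pow_sub_pow_le_mul {a b : ℝ} (hb : 0 ≤ b) (hab : b ≤ a) (n : ℕ) :
    a ^ n - b ^ n ≤ n * (a - b) * a ^ (n - 1) := by
  induction n with
  | zero => simp
  | succ n ih =>
    have ha : 0 ≤ a := hb.trans hab
    have h1 : b ^ n ≤ a ^ n := pow_le_pow_left₀ hb hab n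
    have h2 : a * (a ^ n - b ^ n) ≤ n * (a - b) * a ^ n := by
      cases n with
      | zero => simp
      | succ n =>
        have := mul_le_mul_of_nonneg_left ih ha
        rw [Nat.add_sub_cancel] at this
        rw [pow_succ a n] at *
        nlinarith
    have h3 : (a - b) * b ^ n ≤ (a - b) * a ^ n :=
      mul_le_mul_of_nonneg_left h1 (sub_nonneg.mpr hab)
    rw [Nat.add_sub_cancel, pow_succ, pow_succ]
    push_cast
    nlinarith

/-- The Poisson approximation of the binomial tail. -/
theorem abs_binomTail_sub_poissonTail_le (n : ℕ) {x : ℝ} (hx0 : 0 ≤ x) (hx1 : x ≤ 1) :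
    |binomTail n x - poissonTail (n * x)| ≤ n * ((1 + Real.exp 2) * x ^ 2) := by
  obtain _ | m := n
  · simp [binomTail, poissonTail]
  -- Powers of 1 - x are compared with powers of E, using 0 ≤ E - (1 - x) ≤ x².
  set E := Real.exp (-x) with hE
  have hE0 : 0 < E := Real.exp_pos _
  have hE1 : E ≤ 1 := Real.exp_le_one_iff.mpr (by linarith)
  have hlow : 1 - x ≤ E := by linarith [Real.add_one_le_exp (-x)]
  have hup : E - (1 - x) ≤ x ^ 2 := by
    have := poissonTail_nonneg x
    rw [poissonTail, ← hE] at this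
    nlinarith
  have hexp : Real.exp (-((m + 1 : ℕ) * x)) = E ^ (m + 1) := by
    rw [hE, ← Real.exp_nat_mul]
    ring_nf
  have hy : (m + 1 : ℕ) * x * E ^ (m + 1) ≤ 1 := by
    rw [← hexp, Real.exp_neg, ← div_eq_mul_inv, div_le_one (Real.exp_pos _)]
    linarith [Real.add_one_le_exp ((m + 1 : ℕ) * x)]
  have hn0 : (0 : ℝ) ≤ (m + 1 : ℕ) := Nat.cast_nonneg _
  have hx : 0 ≤ 1 - x := by linarith
  have hnx : 0 ≤ (m + 1 : ℕ) * x := mul_nonneg hn0 hx0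
  have hD1 : 0 ≤ E ^ (m + 1) - (1 - x) ^ (m + 1) := sub_nonneg.mpr (pow_le_pow_left₀ hx hlow _)
  have hD1' : E ^ (m + 1) - (1 - x) ^ (m + 1) ≤ (m + 1 : ℕ) * x ^ 2 := by
    refine (pow_sub_pow_le_mul hx hlow (m + 1)).trans ?_
    refine (mul_le_of_le_one_right (mul_nonneg hn0 (by linarith))
      (pow_le_one₀ hE0.le hE1)).trans ?_
    exact mul_le_mul_of_nonneg_left hup hn0
  have hD2 : (m + 1 : ℕ) * x * (E ^ (m + 1) - (1 - x) ^ m) ≤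
      (m + 1 : ℕ) * (Real.exp 2 * x ^ 2) := by
    have h1 : E ^ m - (1 - x) ^ m ≤ m * x ^ 2 * (Real.exp 2 * E ^ (m + 1)) := by
      refine (pow_sub_pow_le_mul hx hlow m).trans ?_
      obtain _ | k := m
      · simp
      -- The constant e² pays for raising the exponent by 2, as x ≤ 1. The resulting E^n, n = m + 1,
      -- then absorbs the factor n x through n x E^n ≤ 1.
      have h2 : E ^ k ≤ Real.exp 2 * E ^ (k + 1 + 1) := by
        have h3 : 1 ≤ Real.exp 2 * E ^ 2 := by
          rw [hE, ← Real.exp_nat_mul, ← Real.exp_add]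
          exact Real.one_le_exp (by push_cast; linarith)
        have := mul_le_mul_of_nonneg_left h3 (pow_pos hE0 k).le
        calc E ^ k ≤ E ^ k * (Real.exp 2 * E ^ 2) := by linarith
          _ = _ := by ring
      rw [Nat.add_sub_cancel]
      gcongr
    have h2 : E ^ (m + 1) ≤ E ^ m := pow_le_pow_of_le_one hE0.le hE1 (Nat.le_succ m)
    have h3 : (m + 1 : ℕ) * x * (E ^ (m + 1) - (1 - x) ^ m) ≤
        (m + 1 : ℕ) * x * (m * x ^ 2 * (Real.exp 2 * E ^ (m + 1))) :=
      mul_le_mul_of_nonneg_left (by linarith) hnx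
    refine h3.trans ?_
    have h4 : 0 ≤ m * x ^ 2 * Real.exp 2 := by positivity
    have h5 := mul_le_mul_of_nonneg_left hy h4
    have h6 : (m : ℝ) * x ^ 2 * Real.exp 2 ≤ (m + 1 : ℕ) * (Real.exp 2 * x ^ 2) := by
      push_cast
      nlinarith [mul_nonneg (sq_nonneg x) (Real.exp_pos 2).le]
    calc _ = m * x ^ 2 * Real.exp 2 * ((m + 1 : ℕ) * x * E ^ (m + 1)) := by ring
      _ ≤ _ := by linarith
  have hD2' : -((m + 1 : ℕ) * x ^ 2) ≤ (m + 1 : ℕ) * x * (E ^ (m + 1) - (1 - x) ^ m) := by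
    have h1 : (1 - x) ^ m ≤ E ^ m := pow_le_pow_left₀ hx hlow _
    have h2 : E ^ m * (1 - E) ≤ x := by
      have := mul_le_mul_of_nonneg_right (pow_le_one₀ (n := m) hE0.le hE1) (sub_nonneg.mpr hE1)
      linarith
    have h3 : -x ≤ E ^ (m + 1) - (1 - x) ^ m := by
      rw [pow_succ]
      linarith
    have := mul_le_mul_of_nonneg_left h3 hnx
    linarith
  have hsplit : binomTail (m + 1) x - poissonTail ((m + 1 : ℕ) * x) =
      (E ^ (m + 1) - (1 - x) ^ (m + 1)) +
        (m + 1 : ℕ) * x * (E ^ (m + 1) - (1 - x) ^ m) := by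
    rw [binomTail, poissonTail, hexp, Nat.add_sub_cancel]
    ring
  have h7 : 0 ≤ (m + 1 : ℕ) * (Real.exp 2 * x ^ 2) := by positivity
  rw [hsplit, abs_le]
  constructor <;> linarith

theorem binomTail_le_one (n : ℕ) {x : ℝ} (hx0 : 0 ≤ x) (hx1 : x ≤ 1) : binomTail n x ≤ 1 := by
  have h : 0 ≤ 1 - x := by linarith
  have h1 : 0 ≤ (1 - x) ^ n + n * x * (1 - x) ^ (n - 1) := by positivity
  rw [binomTail]
  linarith

theorem tsum_poissonTail_div (p : ℝ) {l : ℝ} (hl : 0 < l) :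
    (∑' α, poissonTail (l * wordProb p α)) / l = meanSize p (Real.log l) := by
  rw [meanSize, Real.exp_neg, Real.exp_log hl, div_eq_inv_mul]

section Expectation

variable {p : ℝ} (hp0 : 0 < p) (hp1 : p < 1)
include hp0 hp1

theorem summable_binomTail (n : ℕ) : Summable fun α => binomTail n (wordProb p α) :=
  Summable.of_nonneg_of_le (fun α => binomTail_nonneg n (wordProb_le_one hp0 hp1 α))
    (fun α => binomTail_le n (wordProb_pos hp0 hp1 α).le (wordProb_le_one hp0 hp1 α))
    ((summable_wordProb_sq hp0 hp1).mul_left _)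

/-- The models with a fixed and with a Poisson number of strings are asymptotically equivalent. -/
theorem tendsto_tsum_binomTail_sub :
    Tendsto (fun n : ℕ => (∑' α, binomTail n (wordProb p α)) / n - meanSize p (Real.log n))
      atTop (𝓝 0) := by
  have hw := fun α => (wordProb_pos hp0 hp1 α).le
  have hw1 := wordProb_le_one hp0 hp1
  have h1 : Tendsto (fun n : ℕ => ∑' α,
      (binomTail n (wordProb p α) - poissonTail (n * wordProb p α)) / n) atTop
      (𝓝 (∑' _α : List Bool, (0 : ℝ))) := by
    -- For each word the difference is at most 1, so division by n sends it to 0; the Poisson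
    -- approximation supplies the summable bound.
    refine tendsto_tsum_of_dominated_convergence (bound := fun α =>
      (1 + Real.exp 2) * wordProb p α ^ 2) ((summable_wordProb_sq hp0 hp1).mul_left _)
      (fun α => ?_) ?_
    · refine squeeze_zero_norm (fun n => ?_) tendsto_one_div_atTop_nhds_zero_nat
      rw [norm_div, Real.norm_natCast]
      refine div_le_div_of_nonneg_right ?_ (Nat.cast_nonneg _)
      have h2 := binomTail_nonneg n (hw1 α)
      have h3 := binomTail_le_one n (hw α) (hw1 α)
      have h4 := poissonTail_nonneg (n * wordProb p α)
      have h5 := poissonTail_le_one (mul_nonneg (Nat.cast_nonneg n) (hw α))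
      rw [Real.norm_eq_abs, abs_le]
      constructor <;> linarith
    · filter_upwards [eventually_gt_atTop 0] with n hn α
      rw [norm_div, Real.norm_natCast, div_le_iff₀' (Nat.cast_pos.mpr hn)]
      exact abs_binomTail_sub_poissonTail_le n (hw α) (hw1 α)
  rw [tsum_zero] at h1
  refine h1.congr' ?_
  filter_upwards [eventually_gt_atTop 0] with n hn
  have hn' : (0 : ℝ) < n := Nat.cast_pos.mpr hn
  rw [tsum_div_const, (summable_binomTail hp0 hp1 n).tsum_sub
    (summable_poissonTail hp0 hp1 hn'.le), sub_div, tsum_poissonTail_div p hn']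

end Expectation

theorem integrable_and_integral_of_lintegral {Ω ι : Type*} [MeasurableSpace Ω] {P : Measure Ω}
    {X : Ω → ℕ} (hX : Measurable fun ω => (X ω : ENNReal)) {c : ι → ℝ} (hc : ∀ i, 0 ≤ c i)
    (hs : Summable c) (h : ∫⁻ ω, X ω ∂P = ∑' i, ENNReal.ofReal (c i)) :
    Integrable (fun ω => (X ω : ℝ)) P ∧ ∫ ω, (X ω : ℝ) ∂P = ∑' i, c i := by
  rw [← ENNReal.ofReal_tsum_of_nonneg hc hs] at h
  have h1 : (fun ω => (X ω : ℝ)) = fun ω => (X ω : ENNReal).toReal := by simp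
  have hne : ∫⁻ ω, X ω ∂P ≠ ⊤ := by rw [h]; exact ENNReal.ofReal_ne_top
  rw [h1]
  refine ⟨integrable_toReal_of_lintegral_ne_top hX.aemeasurable hne, ?_⟩
  rw [integral_toReal hX.aemeasurable (Eventually.of_forall fun ω => ENNReal.natCast_lt_top _), h,
    ENNReal.toReal_ofReal (tsum_nonneg hc)]

/-! ### The Fourier transform of the root term and its decay -/

theorem integrable_of_norm_le_exp {f : ℝ → ℂ} {C : ℝ} (hf : Continuous f)
    (h1 : ∀ t, ‖f t‖ ≤ C * Real.exp t) (h2 : ∀ t, ‖f t‖ ≤ C * Real.exp (-t)) : Integrable f := by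
  rw [← integrableOn_univ, ← Set.Iic_union_Ioi (a := (0 : ℝ))]
  refine IntegrableOn.union ?_ ?_
  · exact Integrable.mono' ((integrableOn_exp_Iic 0).const_mul C) hf.aestronglyMeasurable
      (Eventually.of_forall h1)
  · exact Integrable.mono' ((integrableOn_exp_neg_Ioi 0).const_mul C) hf.aestronglyMeasurable
      (Eventually.of_forall h2)

/-- Euler's integral after the substitution x = e^t. -/
theorem integral_exp_mul_exp_neg_exp {s : ℂ} (hs : 0 < s.re) :
    ∫ t : ℝ, Complex.exp (s * t) * Real.exp (-Real.exp t) = Complex.Gamma s := by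
  rw [Complex.Gamma_eq_integral hs, Complex.GammaIntegral, ← Real.range_exp, ← Set.image_univ,
    integral_image_eq_integral_abs_deriv_smul MeasurableSet.univ
      (fun x _ => (Real.hasDerivAt_exp x).hasDerivWithinAt) Real.exp_injective.injOn,
    setIntegral_univ]
  refine integral_congr_ae (Eventually.of_forall fun t => ?_)
  have h1 : ((Real.exp t : ℝ) : ℂ) ^ (s - 1) = Complex.exp (s * t) * Complex.exp (-t) := by
    rw [Complex.cpow_def_of_ne_zero (by exact_mod_cast (Real.exp_pos t).ne'),
      ← Complex.ofReal_log (Real.exp_pos t).le, Real.log_exp, ← Complex.exp_add]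
    ring_nf
  dsimp only
  rw [abs_of_pos (Real.exp_pos t), h1, Complex.real_smul, Complex.exp_neg, Complex.ofReal_exp t]
  field_simp

theorem sq_mul_exp_neg_le {y : ℝ} (hy : 0 ≤ y) : y ^ 2 * Real.exp (-y) ≤ 2 := by
  have h := Real.quadratic_le_exp_of_nonneg hy
  rw [Real.exp_neg, ← div_eq_mul_inv, div_le_iff₀ (Real.exp_pos y)]
  linarith

/-- The Fourier transform of `rootTerm`. -/
theorem integral_exp_mul_rootTerm (w : ℝ) :
    ∫ t : ℝ, Complex.exp (-(w * t * Complex.I)) * rootTerm t =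
      Complex.Gamma (1 - w * Complex.I) / (1 + w * Complex.I) := by
  have hnorm : ∀ t : ℝ, ‖Complex.exp (-(w * t * Complex.I))‖ = 1 := fun t => by
    rw [show -(w * t * Complex.I) = ((-(w * t) : ℝ) : ℂ) * Complex.I by push_cast; ring,
      Complex.norm_exp_ofReal_mul_I]
  have hc := continuous_rootTerm
  have hKn : ∀ t : ℝ, ‖Complex.exp (-(w * t * Complex.I)) * rootTerm t‖ = rootTerm t := fun t => by
    rw [norm_mul, hnorm, one_mul, Complex.norm_real, Real.norm_of_nonneg (rootTerm_nonneg t)]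
  have hK : Integrable fun t : ℝ => Complex.exp (-(w * t * Complex.I)) * rootTerm t := by
    refine integrable_of_norm_le_exp (C := 1) (by fun_prop) (fun t => ?_) fun t => ?_
    · rw [hKn, one_mul]; exact rootTerm_le_exp t
    · rw [hKn, one_mul]; exact rootTerm_le_exp_neg t
  have hJn : ∀ t : ℝ, ‖Complex.exp ((1 - w * Complex.I) * t) * Real.exp (-Real.exp t)‖ =
      Real.exp t * Real.exp (-Real.exp t) := fun t => by
    rw [norm_mul, Complex.norm_real, Real.norm_of_nonneg (Real.exp_pos _).le, Complex.norm_exp]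
    simp
  have hJ : Integrable fun t : ℝ =>
      Complex.exp ((1 - w * Complex.I) * t) * Real.exp (-Real.exp t) := by
    refine integrable_of_norm_le_exp (C := 2) (by fun_prop) (fun t => ?_) fun t => ?_
    · rw [hJn]
      have : Real.exp (-Real.exp t) ≤ 1 := Real.exp_le_one_iff.mpr (by linarith [Real.exp_pos t])
      nlinarith [Real.exp_pos t]
    · rw [hJn, Real.exp_neg t, ← div_eq_mul_inv, le_div_iff₀ (Real.exp_pos t)]
      linarith [sq_mul_exp_neg_le (Real.exp_pos t).le]
  -- The function tends to 0 at both ends, so its derivative has integral 0; this equates the Gamma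
  -- integral with (1 + i w) times the transform.
  have hd : ∀ t : ℝ, HasDerivAt (fun t : ℝ => Complex.exp (-(w * t * Complex.I)) * rootTerm t)
      (Complex.exp ((1 - w * Complex.I) * t) * Real.exp (-Real.exp t) -
        (1 + w * Complex.I) * (Complex.exp (-(w * t * Complex.I)) * rootTerm t)) t := by
    intro t
    have hr : HasDerivAt rootTerm (Real.exp t * Real.exp (-Real.exp t) - rootTerm t) t := by
      have h1 : HasDerivAt (fun t => Real.exp (-t) * poissonTail (Real.exp t))
          (Real.exp (-t) * -1 * poissonTail (Real.exp t) + Real.exp (-t) *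
            (Real.exp t * Real.exp (-Real.exp t) * Real.exp t)) t :=
        (hasDerivAt_neg t).exp.mul
          ((hasDerivAt_poissonTail (Real.exp t)).comp t (Real.hasDerivAt_exp t))
      convert! h1 using 1
      rw [rootTerm, Real.exp_neg t]
      field_simp
      ring
    have he : HasDerivAt (fun t : ℝ => Complex.exp (-(w * t * Complex.I)))
        (Complex.exp (-(w * t * Complex.I)) * -(w * 1 * Complex.I)) t :=
      ((((hasDerivAt_id t).ofReal_comp.const_mul (w : ℂ)).mul_const Complex.I).neg).cexp
    convert! he.mul hr.ofReal_comp using 1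
    have h2 : Complex.exp ((1 - w * Complex.I) * t) =
        Complex.exp (-(w * t * Complex.I)) * Complex.exp t := by
      rw [← Complex.exp_add]
      ring_nf
    rw [h2]
    push_cast
    ring
  have hlim : ∀ l : Filter ℝ, Tendsto rootTerm l (𝓝 0) → Tendsto (fun t : ℝ =>
      Complex.exp (-(w * t * Complex.I)) * rootTerm t) l (𝓝 0) := fun l hl =>
    squeeze_zero_norm (fun t => (hKn t).le) hl
  have h0 := integral_of_hasDerivAt_of_tendsto hd (hJ.sub (hK.const_mul _))
    (hlim _ (squeeze_zero rootTerm_nonneg rootTerm_le_exp Real.tendsto_exp_atBot))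
    (hlim _ (squeeze_zero rootTerm_nonneg rootTerm_le_exp_neg
      Real.tendsto_exp_neg_atTop_nhds_zero))
  rw [integral_sub hJ (hK.const_mul _), integral_const_mul,
    integral_exp_mul_exp_neg_exp (by simp), sub_zero, sub_eq_zero] at h0
  have hne : (1 : ℂ) + w * Complex.I ≠ 0 := fun h => by
    simpa using congrArg Complex.re h
  rw [eq_div_iff hne, h0, mul_comm]

/-- |Γ(2 - i w)| ≤ Γ(2) = 1, and Γ(2 - i w) = (1 - i w) Γ(1 - i w). The decay makes the Fourier
series absolutely convergent. -/
theorem norm_Gamma_one_sub_mul_I_div_le (w : ℝ) :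
    ‖Complex.Gamma (1 - w * Complex.I) / (1 + w * Complex.I)‖ ≤ 1 / (1 + w ^ 2) := by
  have hne : (1 : ℂ) - w * Complex.I ≠ 0 := fun h => by
    simpa using congrArg Complex.re h
  have h1 : ‖(1 : ℂ) - w * Complex.I‖ ^ 2 = 1 + w ^ 2 := by
    rw [← Complex.normSq_eq_norm_sq, Complex.normSq_apply]
    simp
    ring
  have h2 : ‖(1 : ℂ) + w * Complex.I‖ ^ 2 = 1 + w ^ 2 := by
    rw [← Complex.normSq_eq_norm_sq, Complex.normSq_apply]
    simp
    ring
  have h3 : ‖(1 : ℂ) + w * Complex.I‖ = ‖(1 : ℂ) - w * Complex.I‖ :=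
    (sq_eq_sq₀ (norm_nonneg _) (norm_nonneg _)).mp (h2.trans h1.symm)
  have h4 : ‖Complex.Gamma (1 - w * Complex.I + 1)‖ ≤ 1 := by
    rw [← integral_exp_mul_exp_neg_exp (by simp)]
    have h6 : (∫ t : ℝ, Real.exp (2 * t) * Real.exp (-Real.exp t)) = 1 := by
      have := integral_exp_mul_exp_neg_exp (s := 2) (by simp)
      have h7 : Complex.Gamma 2 = 1 := by
        rw [show (2 : ℂ) = 1 + 1 by norm_num, Complex.Gamma_add_one 1 one_ne_zero]
        simp
      rw [h7] at this
      rw [← Complex.ofReal_inj, ← integral_complex_ofReal, Complex.ofReal_one, ← this]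
      push_cast
      rfl
    refine (norm_integral_le_integral_norm _).trans (le_of_eq ?_)
    rw [← h6]
    congr 1 with t
    rw [norm_mul, Complex.norm_real, Real.norm_of_nonneg (Real.exp_pos _).le, Complex.norm_exp]
    simp [one_add_one_eq_two]
  rw [Complex.Gamma_add_one _ hne, norm_mul] at h4
  rw [norm_div, h3, ← h1]
  have h5 : 0 < ‖(1 : ℂ) - w * Complex.I‖ := norm_pos_iff.mpr hne
  rw [div_le_div_iff₀ h5 (by positivity)]
  nlinarith

theorem trieFourierCoeff_eq (d : ℝ) (k : ℤ) : trieFourierCoeff d k =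
    Complex.Gamma (1 - ((2 * Real.pi * k / d : ℝ) : ℂ) * Complex.I) /
      (1 + ((2 * Real.pi * k / d : ℝ) : ℂ) * Complex.I) := by
  rw [trieFourierCoeff]
  push_cast
  ring_nf

theorem trieFourierCoeff_zero (d : ℝ) : trieFourierCoeff d 0 = 1 := by
  simp [trieFourierCoeff]

theorem summable_norm_trieFourierCoeff {d : ℝ} (hd : 0 < d) :
    Summable fun k : ℤ => ‖trieFourierCoeff d k‖ := by
  have h1 : Summable fun k : ℤ => (d / (2 * Real.pi)) ^ 2 * (1 / (k : ℝ) ^ 2) :=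
    (Real.summable_one_div_int_pow.mpr one_lt_two).mul_left _
  refine Summable.of_norm_bounded_eventually h1 ?_
  filter_upwards [(Set.finite_singleton (0 : ℤ)).compl_mem_cofinite] with k hk
  have hk0 : (k : ℝ) ≠ 0 := by exact_mod_cast hk
  rw [norm_norm, trieFourierCoeff_eq]
  refine (norm_Gamma_one_sub_mul_I_div_le _).trans ?_
  have h2 : (d / (2 * Real.pi)) ^ 2 * (1 / (k : ℝ) ^ 2) = 1 / (2 * Real.pi * k / d) ^ 2 := by
    have := Real.pi_ne_zero
    field_simp
  rw [h2]
  have h3 : 2 * Real.pi * k / d ≠ 0 := by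
    have := Real.pi_ne_zero
    positivity
  have h4 : 0 < (2 * Real.pi * k / d) ^ 2 := by positivity
  gcongr
  linarith

/-- The functional equation of Γ applied twice; z is imaginary and nonzero, so neither -z nor -1 - z
is zero. -/
theorem trieFourierCoeff_eq_mul_Gamma {d : ℝ} (hd : d ≠ 0) {k : ℤ} (hk : k ≠ 0) :
    trieFourierCoeff d k = 2 * Real.pi * Complex.I * k / d *
      Complex.Gamma (-1 - 2 * Real.pi * Complex.I * k / d) := by
  set z : ℂ := 2 * Real.pi * Complex.I * k / d with hz
  have hz' : z = ((2 * Real.pi * k / d : ℝ) : ℂ) * Complex.I := by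
    rw [hz]
    push_cast
    ring
  have hz0 : z ≠ 0 := by
    have h1 : (k : ℂ) ≠ 0 := by exact_mod_cast hk
    have h2 : (d : ℂ) ≠ 0 := by exact_mod_cast hd
    have h3 : (Real.pi : ℂ) ≠ 0 := by exact_mod_cast Real.pi_ne_zero
    simp [hz, h1, h2, h3]
  have hz1 : 1 + z ≠ 0 := fun h => by
    have := congrArg Complex.re h
    rw [hz'] at this
    simp at this
  have hz2 : -1 - z ≠ 0 := fun h => hz1 (by linear_combination -h)
  have hG : Complex.Gamma (1 - z) = -z * ((-1 - z) * Complex.Gamma (-1 - z)) := by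
    rw [← Complex.Gamma_add_one _ hz2, show -1 - z + 1 = -z by ring,
      ← Complex.Gamma_add_one _ (neg_ne_zero.mpr hz0)]
    ring_nf
  rw [trieFourierCoeff, ← hz, hG, div_eq_iff hz1]
  ring

/-! ### Periodization and Poisson summation -/

/-- The periodization of `rootTerm`. -/
noncomputable def periodization (d t : ℝ) : ℝ := d * ∑' k : ℤ, rootTerm (t - k * d)

theorem periodic_periodization (d : ℝ) : Function.Periodic (periodization d) d := by
  intro t
  rw [periodization, periodization, ← (Equiv.addRight (1 : ℤ)).tsum_eq]
  congr 1
  refine tsum_congr fun k => ?_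
  simp only [Equiv.coe_addRight]
  push_cast
  ring_nf

section Fourier

variable {d : ℝ} (hd : 0 < d)

/-- `rootTerm`, rescaled so that the period is `1`. -/
noncomputable def scaledRootTerm (d : ℝ) : C(ℝ, ℂ) where
  toFun x := (rootTerm (d * x) : ℝ)
  continuous_toFun := by
    have := continuous_rootTerm
    fun_prop

theorem periodization_eq (t : ℝ) (hd : d ≠ 0) : (periodization d t : ℂ) =
    d * ∑' n : ℤ, scaledRootTerm d (t / d + n) := by
  rw [periodization, ← (Equiv.neg ℤ).tsum_eq]
  push_cast
  congr 1
  refine tsum_congr fun k => ?_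
  simp only [scaledRootTerm, ContinuousMap.coe_mk, Equiv.neg_apply]
  congr 2
  push_cast
  field_simp
  ring

include hd

theorem fourier_scaledRootTerm (k : ℤ) :
    FourierTransform.fourier (scaledRootTerm d : ℝ → ℂ) (k : ℝ) = trieFourierCoeff d k / d := by
  have hd' : (d : ℂ) ≠ 0 := by exact_mod_cast hd.ne'
  rw [Real.fourier_real_eq_integral_exp_smul, trieFourierCoeff_eq, ← integral_exp_mul_rootTerm]
  have h := Measure.integral_comp_mul_left (fun t : ℝ =>
    Complex.exp (-(((2 * Real.pi * k / d : ℝ) : ℂ) * t * Complex.I)) * rootTerm t) d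
  rw [abs_of_pos (inv_pos.mpr hd), Complex.real_smul, Complex.ofReal_inv] at h
  rw [div_eq_inv_mul, ← h]
  congr 1 with x
  rw [smul_eq_mul]
  simp only [scaledRootTerm, ContinuousMap.coe_mk]
  congr 2
  push_cast
  field_simp

/-- The local summability required by Poisson summation: `rootTerm` decays exponentially at both
ends, hence at least like |x|⁻². -/
theorem summable_norm_restrict_scaledRootTerm (K : TopologicalSpace.Compacts ℝ) :
    Summable fun n : ℤ => ‖((scaledRootTerm d).comp (ContinuousMap.addRight n)).restrict K‖ := by
  have hO : (scaledRootTerm d : ℝ → ℂ) =O[cocompact ℝ] fun x : ℝ => |x| ^ (-2 : ℝ) := by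
    refine IsBigO.of_bound (2 / d ^ 2) ?_
    have h0 : ∀ᶠ x : ℝ in cocompact ℝ, x ≠ 0 :=
      (isCompact_singleton (x := (0 : ℝ))).compl_mem_cocompact
    filter_upwards [h0] with x hx
    have hx0 : 0 < |x| := abs_pos.mpr hx
    have h1 : rootTerm (d * x) ≤ Real.exp (-(d * |x|)) := by
      rcases abs_cases x with ⟨h, -⟩ | ⟨h, -⟩ <;> rw [h]
      · exact rootTerm_le_exp_neg _
      · simpa using rootTerm_le_exp (d * x)
    have h2 := sq_mul_exp_neg_le (y := d * |x|) (by positivity)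
    simp only [scaledRootTerm, ContinuousMap.coe_mk]
    rw [Complex.norm_real, Real.norm_of_nonneg (rootTerm_nonneg _),
      Real.norm_of_nonneg (by positivity), Real.rpow_neg hx0.le, Real.rpow_two]
    refine h1.trans ?_
    rw [div_mul_eq_mul_div, ← div_eq_mul_inv, div_div, le_div_iff₀ (by positivity), ← mul_pow,
      mul_comm |x|]
    linarith
  exact summable_of_isBigO (Real.summable_abs_int_rpow one_lt_two)
    ((isBigO_norm_restrict_cocompact (scaledRootTerm d) two_pos hO K).comp_tendsto
      Int.tendsto_coe_cofinite)

theorem summable_trieFourierCoeff_mul (t : ℝ) : Summable fun k : ℤ =>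
    trieFourierCoeff d k * Complex.exp (2 * Real.pi * Complex.I * k * t / d) := by
  refine Summable.of_norm ((summable_norm_trieFourierCoeff hd).congr fun k => ?_)
  rw [norm_mul, show 2 * Real.pi * Complex.I * k * t / d =
    ((2 * Real.pi * k * t / d : ℝ) : ℂ) * Complex.I by push_cast; ring,
    Complex.norm_exp_ofReal_mul_I, mul_one]

/-- Poisson summation; the factor d in `periodization` cancels the 1/d from rescaling. -/
theorem hasSum_periodization (t : ℝ) : HasSum (fun k : ℤ =>
    trieFourierCoeff d k * Complex.exp (2 * Real.pi * Complex.I * k * t / d))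
    (periodization d t) := by
  have hd' : (d : ℂ) ≠ 0 := by exact_mod_cast hd.ne'
  convert! (summable_trieFourierCoeff_mul hd t).hasSum using 1
  rw [periodization_eq t hd.ne', Real.tsum_eq_tsum_fourier
    (summable_norm_restrict_scaledRootTerm hd), ← tsum_mul_left]
  · refine tsum_congr fun k => ?_
    rw [fourier_scaledRootTerm hd, fourier_coe_apply, ← mul_assoc, mul_div_cancel₀ _ hd']
    congr 2
    push_cast
    field_simp
  · simp only [fourier_scaledRootTerm hd]
    exact (summable_norm_trieFourierCoeff hd).of_norm.div_const _

theorem continuous_periodization : Continuous (periodization d) := by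
  have h1 : Continuous fun t : ℝ => ∑' k : ℤ,
      trieFourierCoeff d k * Complex.exp (2 * Real.pi * Complex.I * k * t / d) := by
    refine continuous_tsum (fun k => by fun_prop) (summable_norm_trieFourierCoeff hd)
      fun k t => le_of_eq ?_
    rw [norm_mul, show 2 * Real.pi * Complex.I * k * t / d =
      ((2 * Real.pi * k * t / d : ℝ) : ℂ) * Complex.I by push_cast; ring,
      Complex.norm_exp_ofReal_mul_I, mul_one]
  simp only [(hasSum_periodization hd _).tsum_eq] at h1
  exact (Complex.continuous_re.comp h1).congr fun t => Complex.ofReal_re _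

theorem integral_periodization_mul_exp (k : ℤ) :
    (1 / (d : ℂ)) * (∫ t in (0 : ℝ)..d, (periodization d t : ℂ) *
      Complex.exp (-(2 * Real.pi * Complex.I * k * t / d))) = trieFourierCoeff d k := by
  have hd' : (d : ℂ) ≠ 0 := by exact_mod_cast hd.ne'
  have h := Real.fourierCoeff_tsum_comp_add (summable_norm_restrict_scaledRootTerm hd) k
  rw [fourier_scaledRootTerm hd, fourierCoeff_eq_intervalIntegral _ k 0, eq_div_iff hd'] at h
  rw [← h]
  have h2 := intervalIntegral.integral_comp_div (a := 0) (b := d) (fun x : ℝ =>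
    (d : ℂ) * (fourier (-k) (x : UnitAddCircle) •
      Function.Periodic.lift ((scaledRootTerm d).periodic_tsum_comp_add_zsmul 1) x)) hd.ne'
  rw [zero_div, div_self hd.ne'] at h2
  rw [zero_add, div_one, one_smul, mul_comm _ (d : ℂ)]
  rw [one_div, inv_mul_eq_iff_eq_mul₀ hd', ← intervalIntegral.integral_const_mul,
    ← Complex.real_smul, ← h2]
  refine intervalIntegral.integral_congr fun t _ => ?_
  rw [periodization_eq t hd.ne', Function.Periodic.lift_coe, fourier_coe_apply, smul_eq_mul]
  simp only [zsmul_one]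
  rw [← ContinuousMap.tsum_apply
    (ContinuousMap.summable_of_locally_summable_norm (summable_norm_restrict_scaledRootTerm hd))]
  simp only [ContinuousMap.comp_apply, ContinuousMap.coe_addRight]
  rw [mul_assoc, mul_comm (tsum _)]
  congr 3
  push_cast
  field_simp

theorem integral_periodization : ∫ t in (0 : ℝ)..d, periodization d t = d := by
  have hd' : (d : ℂ) ≠ 0 := by exact_mod_cast hd.ne'
  have h := integral_periodization_mul_exp hd 0
  rw [trieFourierCoeff_zero, one_div, inv_mul_eq_iff_eq_mul₀ hd', mul_one] at h
  rw [← Complex.ofReal_inj, ← intervalIntegral.integral_ofReal, ← h]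
  simp

theorem integral_exp_period {k : ℤ} (hk : k ≠ 0) :
    ∫ t in (0 : ℝ)..d, Complex.exp (-(2 * Real.pi * Complex.I * k * t / d)) = 0 := by
  have hd' : (d : ℂ) ≠ 0 := by exact_mod_cast hd.ne'
  set c : ℂ := -(2 * Real.pi * Complex.I * k / d) with hc
  have hc0 : c ≠ 0 := by
    have h1 : (k : ℂ) ≠ 0 := by exact_mod_cast hk
    have h3 : (Real.pi : ℂ) ≠ 0 := by exact_mod_cast Real.pi_ne_zero
    simp [hc, h1, hd', h3]
  have h1 : ∀ t : ℝ, -(2 * Real.pi * Complex.I * k * t / d) = c * t := fun t => by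
    rw [hc]
    ring
  simp only [h1]
  rw [integral_exp_mul_complex hc0]
  have h2 : c * (d : ℝ) = (-k : ℤ) * (2 * Real.pi * Complex.I) := by
    rw [hc]
    push_cast
    field_simp
  rw [h2, Complex.exp_int_mul_two_pi_mul_I]
  simp

end Fourier

/-! ### The span of the lattice and the main theorem -/

/-- If the multipliers had a common factor c > 1, then c d would be a larger common divisor than the
maximal d. -/
theorem exists_coprime_of_realGcd {x y : ℝ} (hx : x < 0) (hy : y < 0)
    (h : ¬ Irrational (x / y)) : ∃ A B : ℕ, -x = A * realGcd x y ∧ -y = B * realGcd x y ∧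
      IsCoprime (A : ℤ) (B : ℤ) := by
  obtain ⟨⟨hd, ⟨m, hm⟩, n, hn⟩, hmax⟩ := realGcd_isGreatest hy.ne h
  set d := realGcd x y
  have hneg : ∀ {z : ℝ} {k : ℤ}, z < 0 → z = k * d → -z = k.natAbs * d := by
    intro z k hz hk
    have hk0 : (k : ℝ) < 0 := by
      by_contra h0
      have := mul_nonneg (not_lt.mp h0) hd.le
      linarith
    rw [hk, Nat.cast_natAbs, Int.cast_abs, abs_of_neg hk0]
    ring
  refine ⟨m.natAbs, n.natAbs, hneg hx hm, hneg hy hn, ?_⟩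
  rw [Nat.isCoprime_iff_coprime]
  change Int.gcd m n = 1
  have hm0 : m ≠ 0 := by
    rintro rfl
    simp at hm
    exact hx.ne hm
  have hg : 0 < Int.gcd m n := Int.gcd_pos_of_ne_zero_left n hm0
  obtain ⟨m', hm'⟩ := Int.gcd_dvd_left m n
  obtain ⟨n', hn'⟩ := Int.gcd_dvd_right m n
  have hle : (Int.gcd m n : ℝ) * d ≤ d := by
    refine hmax ⟨by positivity, ⟨m', ?_⟩, n', ?_⟩
    · have : (m : ℝ) = Int.gcd m n * m' := by exact_mod_cast hm'
      rw [hm]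
      linear_combination d * this
    · have : (n : ℝ) = Int.gcd m n * n' := by exact_mod_cast hn'
      rw [hn]
      linear_combination d * this
  have h1 : (Int.gcd m n : ℝ) ≤ 1 := by
    by_contra h0
    nlinarith [not_le.mp h0]
  have h2 : Int.gcd m n ≤ 1 := by exact_mod_cast h1
  omega

theorem mainTheorem5 {Ω : Type*} [MeasurableSpace Ω] (P : Measure Ω) [IsProbabilityMeasure P]
    (p : ℝ) (hp0 : 0 < p) (hp1 : p < 1)
    -- `ξ j i` is the `i`-th letter of the `j`-th string; all letters are i.i.d. `Be(p)`
    (ξ : ℕ → ℕ → Ω → Bool)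
    (hξ_meas : ∀ j i, Measurable (ξ j i))
    (hξ_indep : iIndepFun (fun ji : ℕ × ℕ => ξ ji.1 ji.2) P)
    (hξ_law : ∀ j i, P {ω | ξ j i ω = true} = ENNReal.ofReal p)
    -- `N l` is the `Po(l)` number of strings in the Poisson model
    (N : ℝ≥0 → Ω → ℕ)
    (hN_meas : ∀ l, Measurable (N l))
    (hN_law : ∀ l, P.map (N l) = poissonMeasure l)
    (hN_indep : ∀ l, IndepFun (N l) (fun ω j i => ξ j i ω) P) :
    -- the expectations exist and are finite
    (∀ n : ℕ, Integrable (fun ω => (trieSize (fun j i => ξ j i ω) n : ℝ)) P) ∧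
    (∀ l : ℝ≥0, Integrable (fun ω => (trieSize (fun j i => ξ j i ω) (N l ω) : ℝ)) P) ∧
    -- irrational case
    (Irrational (Real.log p / Real.log (1 - p)) →
      Tendsto (fun l : ℝ≥0 => (∫ ω, (trieSize (fun j i => ξ j i ω) (N l ω) : ℝ) ∂P) / (l : ℝ))
        atTop (𝓝 (1 / Real.binEntropy p)) ∧
      Tendsto (fun n : ℕ => (∫ ω, (trieSize (fun j i => ξ j i ω) n : ℝ) ∂P) / (n : ℝ))
        atTop (𝓝 (1 / Real.binEntropy p))) ∧
    -- rational case
    (¬ Irrational (Real.log p / Real.log (1 - p)) →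
      ∃ d : ℝ, d = realGcd (Real.log p) (Real.log (1 - p)) ∧ 0 < d ∧
      ∃ ψ : ℝ → ℝ, Continuous ψ ∧ Function.Periodic ψ d ∧
        (∫ t in (0 : ℝ)..d, ψ t) = 0 ∧
        (∀ k : ℤ, k ≠ 0 →
          (1 / (d : ℂ)) * (∫ t in (0 : ℝ)..d,
            (ψ t : ℂ) * Complex.exp (-(2 * Real.pi * Complex.I * k * t / d))) =
              trieFourierCoeff d k) ∧
        (∀ t : ℝ, HasSum (fun k : {k : ℤ // k ≠ 0} =>
          trieFourierCoeff d k * Complex.exp (2 * Real.pi * Complex.I * (k : ℤ) * t / d))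
          (ψ t : ℂ)) ∧
        (∀ t : ℝ, HasSum (fun k : {k : ℤ // k ≠ 0} =>
          2 * Real.pi * Complex.I * (k : ℤ) / d *
            Complex.Gamma (-1 - 2 * Real.pi * Complex.I * (k : ℤ) / d) *
            Complex.exp (2 * Real.pi * Complex.I * (k : ℤ) * t / d))
          (ψ t : ℂ)) ∧
        ((fun l : ℝ≥0 => (∫ ω, (trieSize (fun j i => ξ j i ω) (N l ω) : ℝ) ∂P) / (l : ℝ) -
            (1 / Real.binEntropy p + 1 / Real.binEntropy p * ψ (Real.log l)))
          =o[atTop] (fun _ => (1 : ℝ))) ∧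
        ((fun n : ℕ => (∫ ω, (trieSize (fun j i => ξ j i ω) n : ℝ) ∂P) / (n : ℝ) -
            (1 / Real.binEntropy p + 1 / Real.binEntropy p * ψ (Real.log n)))
          =o[atTop] (fun _ => (1 : ℝ)))) := by
  have hq0 : 0 < 1 - p := by linarith
  have hlogp : Real.log p < 0 := Real.log_neg hp0 hp1
  have hlogq : Real.log (1 - p) < 0 := Real.log_neg hq0 (by linarith)
  have hX : Measurable fun ω j i => ξ j i ω :=
    measurable_pi_lambda _ fun j => measurable_pi_lambda _ fun i => hξ_meas j i
  have hfix : ∀ n : ℕ, Integrable (fun ω => (trieSize (fun j i => ξ j i ω) n : ℝ)) P ∧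
      ∫ ω, (trieSize (fun j i => ξ j i ω) n : ℝ) ∂P = ∑' α, binomTail n (wordProb p α) := fun n =>
    integrable_and_integral_of_lintegral ((measurable_trieSize n).comp hX)
      (fun α => binomTail_nonneg n (wordProb_le_one hp0 hp1 α)) (summable_binomTail hp0 hp1 n)
      (lintegral_trieSize hp0 hp1 hξ_meas hξ_indep hξ_law n)
  have hpoi : ∀ l : ℝ≥0, Integrable (fun ω => (trieSize (fun j i => ξ j i ω) (N l ω) : ℝ)) P ∧
      ∫ ω, (trieSize (fun j i => ξ j i ω) (N l ω) : ℝ) ∂P =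
        ∑' α, poissonTail (l * wordProb p α) := fun l => by
    have hF : Measurable fun y : ℕ × (ℕ → BinString) => (trieSize y.2 y.1 : ENNReal) :=
      measurable_from_prod_countable_right measurable_trieSize
    exact integrable_and_integral_of_lintegral (hF.comp ((hN_meas l).prodMk hX))
      (fun α => poissonTail_nonneg _) (summable_poissonTail hp0 hp1 l.2)
      (lintegral_trieSize_poisson hp0 hp1 hξ_meas hξ_indep hξ_law (hN_meas l) (hN_law l)
        (hN_indep l))
  have hlogl : Tendsto (fun l : ℝ≥0 => Real.log l) atTop atTop :=
    Real.tendsto_log_atTop.comp (NNReal.tendsto_coe_atTop.mpr tendsto_id)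
  have hlogn : Tendsto (fun n : ℕ => Real.log n) atTop atTop :=
    Real.tendsto_log_atTop.comp tendsto_natCast_atTop_atTop
  have hpoi' : ∀ᶠ l : ℝ≥0 in atTop, (∫ ω, (trieSize (fun j i => ξ j i ω) (N l ω) : ℝ) ∂P) / (l : ℝ)
      = meanSize p (Real.log l) := by
    filter_upwards [eventually_gt_atTop 0] with l hl
    rw [(hpoi l).2, tsum_poissonTail_div p (NNReal.coe_pos.mpr hl)]
  have hdiff : Tendsto (fun n : ℕ => (∫ ω, (trieSize (fun j i => ξ j i ω) n : ℝ) ∂P) / (n : ℝ) -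
      meanSize p (Real.log n)) atTop (𝓝 0) := by
    simp only [fun n => (hfix n).2]
    exact tendsto_tsum_binomTail_sub hp0 hp1
  refine ⟨fun n => (hfix n).1, fun l => (hpoi l).1, fun hirr => ?_, fun hrat => ?_⟩
  · have hu := tendsto_meanSize_of_irrational hp0 hp1 hirr
    refine ⟨(hu.comp hlogl).congr' (hpoi'.mono fun l hl => hl.symm), ?_⟩
    simpa using hdiff.add (hu.comp hlogn)
  · obtain ⟨A, B, hA, hB, hAB⟩ := exists_coprime_of_realGcd hlogp hlogq hrat
    have hd := (realGcd_isGreatest hlogq.ne hrat).1.1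
    refine ⟨_, rfl, hd, ?_⟩
    set d := realGcd (Real.log p) (Real.log (1 - p))
    have hu := tendsto_meanSize_sub_of_lattice hp0 hp1 hd hA hB hAB
    have hc := continuous_periodization hd
    -- The coefficient at k = 0 is 1, so ψ is the periodization minus its mean 1; the other
    -- coefficients are unchanged.
    have hsum : ∀ t : ℝ, HasSum (fun k : {k : ℤ // k ≠ 0} =>
        trieFourierCoeff d k * Complex.exp (2 * Real.pi * Complex.I * (k : ℤ) * t / d))
        ((periodization d t - 1 : ℝ) : ℂ) := by
      intro t
      have h1 := (hasSum_periodization hd t).sub (hasSum_ite_eq (0 : ℤ) (1 : ℂ))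
      rw [← Complex.ofReal_one, ← Complex.ofReal_sub] at h1
      rw [← hasSum_subtype_iff_of_support_subset (s := {k : ℤ | k ≠ 0})] at h1
      · refine h1.congr_fun fun k => ?_
        have hk : (k : ℤ) ≠ 0 := k.2
        simp [hk]
      · rintro k hk rfl
        simp [trieFourierCoeff_zero] at hk
    refine ⟨fun t => periodization d t - 1, by fun_prop, fun t => ?_, ?_, fun k hk => ?_, hsum,
      fun t => ?_, ?_, ?_⟩
    · simp only [periodic_periodization d t]
    · rw [intervalIntegral.integral_sub (hc.intervalIntegrable _ _) intervalIntegrable_const,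
        integral_periodization hd]
      simp
    · have h1 : ∀ t : ℝ, ((periodization d t - 1 : ℝ) : ℂ) *
          Complex.exp (-(2 * Real.pi * Complex.I * k * t / d)) =
          (periodization d t : ℂ) * Complex.exp (-(2 * Real.pi * Complex.I * k * t / d)) -
            Complex.exp (-(2 * Real.pi * Complex.I * k * t / d)) := fun t => by
        push_cast
        ring
      simp only [h1]
      rw [intervalIntegral.integral_sub (Continuous.intervalIntegrable (by fun_prop) _ _)
        (Continuous.intervalIntegrable (by fun_prop) _ _), integral_exp_period hd hk, sub_zero,
        integral_periodization_mul_exp hd]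
    · exact (hsum t).congr_fun fun k => by rw [trieFourierCoeff_eq_mul_Gamma hd.ne' k.2]
    · rw [isLittleO_one_iff]
      refine (hu.comp hlogl).congr' ?_
      filter_upwards [hpoi'] with l hl
      rw [hl, Function.comp_apply, periodization]
      ring
    · rw [isLittleO_one_iff]
      have h1 := hdiff.add (hu.comp hlogn)
      rw [add_zero] at h1
      refine h1.congr fun n => ?_
      simp only [Function.comp_apply, periodization]
      ring
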